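/- Let $\Bbbk$ be a field. All graphs are finite and simple. A graph is very well-covered if it has no isolated vertices and all its minimal vertex covers have cardinality equal to half the number of its vertices; ${\rm Min}(H)$ denotes the set of minimal vertex covers of $H$. Let $H$ be a very well-covered graph on the vertices $x_1,\dots,x_{d_0},y_1,\dots,y_{d_0}$ such that $\{x_1,\dots,x_{d_0}\}$ is a minimal vertex cover, $\{y_1,\dots,y_{d_0}\}$ is a maximal independent set, $x_iy_i\in E(H)$ for all $i$, and $x_iy_j\in E(H)$ implies $i\le j$. (Every Cohen--Macaulay very well-covered graph has such a labelling, and conversely every very well-covered graph with such a labelling is Cohen--Macaulay.) Let $n_1,\dots,n_{d_0}$ be positive integers, put $d=\sum_i n_i$, and let $G\cong H(n_1,\dots,n_{d_0})$ be the very well-covered graph obtained from $H$ by replacing each edge $x_iy_i$ by a complete bipartite graph $K_{n_i,n_i}$: its vertices are $x_{ia},y_{ia}$ ($1\le i\le d_0$, $1\le a\le n_i$), and copies of two vertices of $H$ are adjacent exactly when these vertices are adjacent in $H$. For $C\in{\rm Min}(H)$ let $$\mathcal C(H;C)=\{x_s : y_s\in C \text{ and } (C\setminus\{y_s\})\cup\{x_s\}\in{\rm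 Min}(H)\},$$ and for $B\subseteq V(H)$ let $N_B=\sum n_s$, the sum running over those $s$ with $x_s\in B$ or $y_s\in B$. Let $S=\Bbbk[V(G)]$, let $\mathfrak m$ be its graded maximal ideal, and let $I(G)=(uv : \{u,v\}\in E(G))$ be the edge ideal of $G$. Then for every positive integer $j$ all graded pieces of $H^j_{\mathfrak m}(S/I(G))$ are finite-dimensional, and $$\sum_{\ell\in\mathbb Z}\dim_\Bbbk\big[H^j_{\mathfrak m}(S/I(G))\big]_\ell\,t^\ell=\sum_i\ \sum_{C\in{\rm Min}(H)}\big|\{D\subseteq\mathcal C(H;C) : d+N_D=|V(G)|-j+i,\ |D|=i\}\big|\left(\frac{t^{-1}}{1-t^{-1}}\right)^{j-i}$$ as formal Laurent series in $t^{-1}$. -/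

import Mathlib

noncomputable section

/-! ### Graphs -/

open Classical in
/-- `Min(G)`: the minimal vertex covers of `G`. -/
def minVertexCovers {V : Type*} [Fintype V] (G : SimpleGraph V) : Finset (Finset V) :=
  Finset.univ.filter fun C => Minimal G.IsVertexCover (C : Set V)

/-- A graph is very well-covered if it has no isolated vertices and all its minimal vertex covers
have cardinality equal to half the number of vertices. -/
def IsVeryWellCovered {V : Type*} [Fintype V] (G : SimpleGraph V) : Prop :=
  (∀ v, ∃ w, G.Adj v w) ∧ ∀ C ∈ minVertexCovers G, 2 * C.card = Fintype.card V

/-- The standard labelling of a Cohen-Macaulay very well-covered graph on the vertices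
`x_i = Sum.inl i` and `y_i = Sum.inr i`: the `x_i` form a minimal vertex cover, the `y_i` form a
maximal independent set, every `x_i y_i` is an edge, and if `x_i y_j` is an edge then `i ≤ j`. -/
structure IsStandardLabelling {d₀ : ℕ} (H : SimpleGraph (Fin d₀ ⊕ Fin d₀)) : Prop where
  minimal_cover : Minimal H.IsVertexCover (Set.range Sum.inl)
  maximal_indep : Maximal H.IsIndepSet (Set.range Sum.inr)
  matching : ∀ i, H.Adj (Sum.inl i) (Sum.inr i)
  le_of_adj : ∀ i j, H.Adj (Sum.inl i) (Sum.inr j) → i ≤ j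

/-- The vertices `x_{i1}, …, x_{in_i}` (left) and `y_{i1}, …, y_{in_i}` (right), over all `i`. -/
abbrev ReplacedVertex {d₀ : ℕ} (n : Fin d₀ → ℕ) : Type :=
  (Σ i, Fin (n i)) ⊕ (Σ i, Fin (n i))

/-- `H(n_1, …, n_{d₀})`: every edge `x_i y_i` of `H` is replaced by the complete bipartite graph
`K_{n_i, n_i}`. Copies of `x_i` (or `y_i`) have the copies of the neighbours of `x_i` (or `y_i`)
as neighbours; since `x_i y_i` is an edge of `H`, this includes all edges `x_{ia} y_{ib}`. -/
def replaceEdges {d₀ : ℕ} (H : SimpleGraph (Fin d₀ ⊕ Fin d₀)) (n : Fin d₀ → ℕ) :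
    SimpleGraph (ReplacedVertex n) :=
  H.comap (Sum.map Sigma.fst Sigma.fst)

open Classical in
/-- `𝒞(H; C)`: the set of those `x_s` for which `y_s ∈ C` and `(C \ {y_s}) ∪ {x_s}` is again a
minimal vertex cover of `H`. -/
def exchangeSet {d₀ : ℕ} (H : SimpleGraph (Fin d₀ ⊕ Fin d₀)) (C : Finset (Fin d₀ ⊕ Fin d₀)) :
    Finset (Fin d₀ ⊕ Fin d₀) :=
  Finset.univ.filter fun v => ∃ s : Fin d₀, v = Sum.inl s ∧ Sum.inr s ∈ C ∧
    insert (Sum.inl s) (C.erase (Sum.inr s)) ∈ minVertexCovers H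

/-- `N_B`: the sum of the `n_s` over those `s` with `x_s ∈ B` or `y_s ∈ B`. -/
def weightOf {d₀ : ℕ} (n : Fin d₀ → ℕ) (B : Finset (Fin d₀ ⊕ Fin d₀)) : ℕ :=
  ∑ s ∈ Finset.univ.filter (fun s => Sum.inl s ∈ B ∨ Sum.inr s ∈ B), n s

/-! ### Edge ideals and graded local cohomology -/

/-- The edge ideal `I(G)` of `k[V(G)]`. -/
def edgeIdeal (k : Type*) [Field k] {V : Type*} (G : SimpleGraph V) : Ideal (MvPolynomial V k) :=
  Ideal.span {f | ∃ u v, G.Adj u v ∧ f = MvPolynomial.X u * MvPolynomial.X v}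

section Cech

variable {k : Type*} [Field k] {V : Type*} (I : Ideal (MvPolynomial V k))

/-- The image in `S/I` of the product `x_F` of the variables in `F`. -/
def varProd (F : Finset V) : MvPolynomial V k ⧸ I :=
  Ideal.Quotient.mk I (∏ v ∈ F, MvPolynomial.X v)

/-- The localization `(S/I)_{x_F}`. -/
abbrev CechLoc (F : Finset V) : Type _ := Localization.Away (varProd I F)

/-- `p` is homogeneous of the (possibly negative) degree `e`; for `e < 0` this means `p = 0`. -/
def IsHomogeneousOfIntDegree (p : MvPolynomial V k) (e : ℤ) : Prop :=
  ∀ a ∈ p.support, (a.degree : ℤ) = e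

theorem IsHomogeneousOfIntDegree.mul_prod_pow {p : MvPolynomial V k} {e : ℤ}
    (hp : IsHomogeneousOfIntDegree p e) (F : Finset V) (s : ℕ) :
    IsHomogeneousOfIntDegree (p * (∏ v ∈ F, MvPolynomial.X v) ^ s) (e + s * F.card) := by
  classical
  have hF : ((∏ v ∈ F, MvPolynomial.X v : MvPolynomial V k) ^ s).IsHomogeneous (F.card * s) := by
    have h := MvPolynomial.IsHomogeneous.prod F (fun v => (MvPolynomial.X v : MvPolynomial V k))
      (fun _ => 1) (fun v _ => MvPolynomial.isHomogeneous_X k v)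
    simpa using h.pow s
  intro a ha
  obtain ⟨b, hb, c, hc, rfl⟩ := Finset.mem_add.mp (MvPolynomial.support_mul _ _ ha)
  have h1 := hp b hb
  have h2 := hF (MvPolynomial.mem_support_iff.mp hc)
  have h3 : Finsupp.degree c = F.card * s := by rw [Finsupp.degree_eq_weight_one]; exact h2
  rw [map_add, h3]
  push_cast
  rw [h1]
  ring

/-- The degree `ℓ` part of `(S/I)_{x_F}`: the fractions `p / x_F ^ s` with `p` homogeneous of
degree `ℓ + s |F|`. -/
def cechLocDegree (F : Finset V) (ℓ : ℤ) : Submodule k (CechLoc I F) where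
  carrier := {z | ∃ (s : ℕ) (p : MvPolynomial V k),
    IsHomogeneousOfIntDegree p (ℓ + s * F.card) ∧
    z * algebraMap _ (CechLoc I F) (varProd I F ^ s) =
      algebraMap _ (CechLoc I F) (Ideal.Quotient.mk I p)}
  zero_mem' := ⟨0, 0, by simp [IsHomogeneousOfIntDegree], by simp⟩
  add_mem' := by
    classical
    rintro z w ⟨s, p, hp, hz⟩ ⟨t, q, hq, hw⟩
    refine ⟨s + t, p * (∏ v ∈ F, MvPolynomial.X v) ^ t + q * (∏ v ∈ F, MvPolynomial.X v) ^ s,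
      ?_, ?_⟩
    · intro a ha
      rcases Finset.mem_union.mp (MvPolynomial.support_add ha) with h | h
      · rw [hp.mul_prod_pow F t a h]; push_cast; ring
      · rw [hq.mul_prod_pow F s a h]; push_cast; ring
    · have hx : Ideal.Quotient.mk I (∏ v ∈ F, MvPolynomial.X v) = varProd I F := rfl
      simp only [map_add, map_mul, map_pow, hx, pow_add] at hz hw ⊢
      rw [← hz, ← hw]
      ring
  smul_mem' := by
    rintro c z ⟨s, p, hp, hz⟩
    refine ⟨s, c • p, fun a ha => hp a (MvPolynomial.support_smul ha), ?_⟩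
    have h1 : Ideal.Quotient.mk I (c • p) = c • Ideal.Quotient.mk I p := rfl
    rw [smul_mul_assoc, hz, h1]
    exact (map_smul (IsScalarTower.toAlgHom k (MvPolynomial V k ⧸ I) (CechLoc I F)) c _).symm

theorem isUnit_varProd_of_subset {E F : Finset V} (h : E ⊆ F) :
    IsUnit (IsScalarTower.toAlgHom k (MvPolynomial V k ⧸ I) (CechLoc I F) (varProd I E)) := by
  refine IsLocalization.Away.isUnit_of_dvd (varProd I F) ?_
  exact map_dvd _ (Finset.prod_dvd_prod_of_subset _ _ _ h)

/-- The localization map `(S/I)_{x_E} → (S/I)_{x_F}` for `E ⊆ F`. -/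
def cechRes {E F : Finset V} (h : E ⊆ F) : CechLoc I E →ₐ[k] CechLoc I F :=
  IsLocalization.Away.liftAlgHom (x := varProd I E) (isUnit_varProd_of_subset I h)

/-- The module `C^j = ⨁_{|F| = j} (S/I)_{x_F}` of Čech cochains on the variables. -/
abbrev CechCochain [Fintype V] (j : ℕ) : Type _ :=
  ∀ F : {F : Finset V // F.card = j}, CechLoc I F.1

/-- The Čech differential `C^j → C^{j+1}`,
`(d c)_F = ∑_{a ∈ F} (-1)^{#{b ∈ F, b < a}} c_{F \ {a}}`. -/
def cechDiff [Fintype V] [LinearOrder V] (j : ℕ) :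
    CechCochain I j →ₗ[k] CechCochain I (j + 1) :=
  LinearMap.pi fun F => ∑ a : {a // a ∈ F.1},
    (-1 : k) ^ (F.1.filter (· < a.1)).card •
      ((cechRes I (Finset.erase_subset a.1 F.1)).toLinearMap ∘ₗ
        LinearMap.proj (R := k) (φ := fun E : {E : Finset V // E.card = j} => CechLoc I E.1)
          ⟨F.1.erase a.1, by rw [Finset.card_erase_of_mem a.2, F.2, Nat.add_sub_cancel]⟩)

/-- The degree `ℓ` part of `C^j`. -/
def cechCochainDegree [Fintype V] (j : ℕ) (ℓ : ℤ) : Submodule k (CechCochain I j) :=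
  Submodule.pi Set.univ fun F => cechLocDegree I F.1 ℓ

/-- The cocycles of degree `ℓ` in `C^j`. -/
def cechCocycles [Fintype V] [LinearOrder V] (j : ℕ) (ℓ : ℤ) : Submodule k (CechCochain I j) :=
  cechCochainDegree I j ℓ ⊓ LinearMap.ker (cechDiff I j)

/-- The coboundaries of degree `ℓ` in `C^j`. -/
def cechCoboundaries [Fintype V] [LinearOrder V] :
    ∀ (j : ℕ) (_ : ℤ), Submodule k (CechCochain I j)
  | 0, _ => ⊥
  | j + 1, ℓ => (cechCochainDegree I j ℓ).map (cechDiff I j)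

/-- The degree `ℓ` part of the local cohomology module `H^j_𝔪(S/I)` of the graded ring `S/I`
(for a homogeneous ideal `I`), where `𝔪` is generated by the variables: the degree `ℓ` part of the
cohomology of the Čech complex of `S/I` on the variables. -/
abbrev LocalCohomologyDegree [Fintype V] [LinearOrder V] (j : ℕ) (ℓ : ℤ) : Type _ :=
  cechCocycles I j ℓ ⧸ (cechCoboundaries I j ℓ).submoduleOf (cechCocycles I j ℓ)

end Cech

/-- The variable `t⁻¹` of the field of formal Laurent series in `t⁻¹`; the coefficient of `t ^ ℓ`
in a series `f` is `f.coeff (-ℓ)`. -/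
def tInv : LaurentSeries ℚ := HahnSeries.single 1 1

end

/-! The Čech complex of `S/I(G)` splits over the multidegrees `a ∈ ℤ^V`. In degree `a` the
localization at `x_F` is one-dimensional if `F` contains every `v` with `a v < 0` and `F ∪ supp a`
is independent, and zero otherwise. So each strand is the simplicial cochain complex of a convex
family of finite sets (`cochainCoeff_cechDiff`). If some `a v > 0`, the family is stable under
adding and removing `v`, and the strand is exact. If `a ≤ 0`, the family consists of the independent
sets containing `N = supp a`. Only finitely many `a ≤ 0` have a given sum, which gives finiteness
and a sum formula for the dimension (`finrank_localCohomologyDegree`).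

The facets of the independence complex of `H` are the sets `{x_s : s ∈ A} ∪ {y_s : s ∉ A}`, the
complements of the minimal covers `C`. Let `R(A)` be the set of `s ∈ A` such that exchanging `x_s`
for `y_s` gives another facet; this is `𝒞(H; C)`. Transitivity of adjacency
(`IsVeryWellCovered.adj_trans`) and the order of the labelling show that the intervals from `{x_s :
s ∈ R(A)}` to the facet of `A` partition the complex (`dominatedIndices_eq_iff`). The facet of a
face `σ` is found by taking for `A` the indices `s` with `y_s` adjacent to `σ`. In `G`, containing
`x_s` becomes meeting the fibre over `x_s`.

Choose a base point in every fibre of `V(G) → V(H)`, outside `N` if possible, and group the faces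
containing `N` by their facet and their elements that are not base points. A group is either stable
under toggling a base point, hence acyclic, or critical. Critical faces have the form `N ∪ {base
points over x_s : s ∈ D}`, where `D ⊆ R(A)` and `N` is the full preimage of the facet of `A` without
`{x_s : s ∈ D}`. As `|D| = d₀ - |π(N)|`, they all have the same cardinality, so the cohomology sits
in one degree and the Euler characteristic gives its dimension (`finrank_cohomology_starFamily`).

Each pair `(A, D)` thus contributes in cohomological degree `j = |N| + |D|` with `|N| = d - N_D`,
once for every `a ≤ 0` of support `N`. These vectors have generating function `(t⁻¹/(1 - t⁻¹))^|N|`,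
and `|N| = j - |D|`. -/

noncomputable section

/-! ### Cochains on convex families of finite sets -/

set_option linter.unusedSectionVars false

namespace SetFamily

section

variable (k : Type*) [Field k] {V : Type*} [LinearOrder V]

/-- The sign with which `F.erase v` occurs in the boundary of `F`. -/
def eraseSign (v : V) (F : Finset V) : k := (-1) ^ (F.filter (· < v)).card

theorem eraseSign_mul_self (v : V) (F : Finset V) : eraseSign k v F * eraseSign k v F = 1 := by
  rw [eraseSign, ← mul_pow]; simp

theorem eraseSign_erase_of_not_lt {v w : V} (h : ¬ w < v) (F : Finset V) :
    eraseSign k v (F.erase w) = eraseSign k v F := by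
  have : (F.erase w).filter (· < v) = F.filter (· < v) := by
    ext x
    simp only [Finset.mem_filter, Finset.mem_erase]
    constructor
    · tauto
    · rintro ⟨h1, h2⟩
      exact ⟨⟨fun e => h (e ▸ h2), h1⟩, h2⟩
  rw [eraseSign, this, eraseSign]

theorem eraseSign_erase_of_lt {v w : V} (h : w < v) {F : Finset V} (hw : w ∈ F) :
    eraseSign k v (F.erase w) = -eraseSign k v F := by
  have h1 : (F.erase w).filter (· < v) = (F.filter (· < v)).erase w := by
    ext x
    simp only [Finset.mem_filter, Finset.mem_erase]
    tauto
  have h2 : w ∈ F.filter (· < v) := by simp [hw, h]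
  rw [eraseSign, eraseSign, h1, ← Finset.card_erase_add_one h2, pow_succ]
  ring

/-- Deleting the smaller of the two elements flips the sign of the larger one; deleting the larger
changes nothing. So exactly one factor changes sign. -/
theorem eraseSign_mul_eraseSign {v w : V} {F : Finset V} (hvw : v ≠ w) (hv : v ∈ F) (hw : w ∈ F) :
    eraseSign k v (F.erase w) * eraseSign k w (F.erase v) =
      -(eraseSign k v F * eraseSign k w F) := by
  rcases lt_or_gt_of_ne hvw with h | h
  · rw [eraseSign_erase_of_not_lt k (not_lt_of_gt h), eraseSign_erase_of_lt k h hv]; ring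
  · rw [eraseSign_erase_of_not_lt k (not_lt_of_gt h), eraseSign_erase_of_lt k h hw]; ring

theorem eraseSign_swap {v w : V} {F : Finset V} (hvw : v ≠ w) (hv : v ∈ F) (hw : w ∈ F) :
    eraseSign k v F * eraseSign k w (F.erase v) =
      -(eraseSign k w F * eraseSign k v (F.erase w)) := by
  rcases lt_or_gt_of_ne hvw with h | h
  · rw [eraseSign_erase_of_not_lt k (not_lt_of_gt h), eraseSign_erase_of_lt k h hv]; ring
  · rw [eraseSign_erase_of_not_lt k (not_lt_of_gt h), eraseSign_erase_of_lt k h hw]; ring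

/-- The simplicial coboundary restricted to a family `K` of finite sets. -/
def coboundary (K : Finset (Finset V)) : (Finset V → k) →ₗ[k] (Finset V → k) where
  toFun c F := if F ∈ K then ∑ v ∈ F, eraseSign k v F * c (F.erase v) else 0
  map_add' c c' := by
    funext F
    by_cases h : F ∈ K <;> simp [h, mul_add, Finset.sum_add_distrib]
  map_smul' r c := by
    funext F
    by_cases h : F ∈ K <;> simp [h, Finset.mul_sum, mul_left_comm]

variable {k}

theorem coboundary_apply (K : Finset (Finset V)) (c : Finset V → k) (F : Finset V) :
    coboundary k K c F = if F ∈ K then ∑ v ∈ F, eraseSign k v F * c (F.erase v) else 0 := rfl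

/-- Convexity makes the truncation to `K` harmless: if `F` and `F \ {v, w}` lie in `K`, so does `F \
{v}`. The double sum then cancels under swapping `v` and `w`. -/
theorem coboundary_coboundary {K : Finset (Finset V)} (hK : (K : Set (Finset V)).OrdConnected)
    {c : Finset V → k} (hc : ∀ F ∉ K, c F = 0) : coboundary k K (coboundary k K c) = 0 := by
  funext F
  rw [coboundary_apply, Pi.zero_apply]
  split_ifs with hF
  swap; · rfl
  have h1 : ∀ v ∈ F, eraseSign k v F * coboundary k K c (F.erase v) =
      ∑ w ∈ F.erase v, eraseSign k v F * (eraseSign k w (F.erase v) *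
        c ((F.erase v).erase w)) := by
    intro v hv
    rw [coboundary_apply, ← Finset.mul_sum]
    split_ifs with h
    · rfl
    · rw [Finset.sum_eq_zero]
      intro w hw
      rw [hc _ fun h' => h (hK.out (Finset.mem_coe.2 h') (Finset.mem_coe.2 hF)
        ⟨Finset.erase_subset _ _, Finset.erase_subset _ _⟩), mul_zero]
  rw [Finset.sum_congr rfl h1, Finset.sum_sigma']
  refine Finset.sum_involution (fun p _ => ⟨p.2, p.1⟩) ?_ ?_ ?_ ?_
  · rintro ⟨v, w⟩ h
    simp only [Finset.mem_sigma, Finset.mem_erase] at h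
    have := eraseSign_swap k (Ne.symm h.2.1) h.1 h.2.2
    simp only
    rw [← mul_assoc, ← mul_assoc, this, Finset.erase_right_comm]
    ring
  · rintro ⟨v, w⟩ h _ h'
    simp only [Finset.mem_sigma, Finset.mem_erase] at h
    simp only [Sigma.mk.injEq] at h'
    exact h.2.1 h'.1
  · rintro ⟨v, w⟩ h
    simp only [Finset.mem_sigma, Finset.mem_erase] at h ⊢
    exact ⟨h.2.2, Ne.symm h.2.1, h.1⟩
  · rintro ⟨v, w⟩ _
    rfl

/-- Every degree `j` cocycle of the family `K` is a coboundary. -/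
def ExactAt (k : Type*) [Field k] (K : Finset (Finset V)) (j : ℕ) : Prop :=
  ∀ c : Finset V → k, (∀ F, c F ≠ 0 → F ∈ K ∧ F.card = j) → coboundary k K c = 0 →
    ∃ e : Finset V → k, (∀ F, e F ≠ 0 → F ∈ K ∧ F.card + 1 = j) ∧ coboundary k K e = c

/-- `K` is stable under adding and removing `v`. -/
def ToggleInvariant (K : Finset (Finset V)) (v : V) : Prop :=
  ∀ F, insert v F ∈ K ↔ F.erase v ∈ K

theorem ToggleInvariant.insert_mem {K : Finset (Finset V)} {v : V} (h : ToggleInvariant K v)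
    {F : Finset V} (hF : F ∈ K) : insert v F ∈ K := by
  by_cases hv : v ∈ F
  · rwa [Finset.insert_eq_of_mem hv]
  · rwa [h, Finset.erase_eq_of_notMem hv]

theorem ToggleInvariant.erase_mem {K : Finset (Finset V)} {v : V} (h : ToggleInvariant K v)
    {F : Finset V} (hF : F ∈ K) : F.erase v ∈ K := by
  by_cases hv : v ∈ F
  · rwa [← h, Finset.insert_eq_of_mem hv]
  · rwa [Finset.erase_eq_of_notMem hv]

/-- Cone construction: adding `v` is a contracting homotopy, with primitive `e F = ± c (F ∪ {v})`
for `v ∉ F`. -/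
theorem ToggleInvariant.exactAt {K : Finset (Finset V)} {v : V} (h : ToggleInvariant K v) (j : ℕ) :
    ExactAt k K j := by
  intro c hc hdc
  let e : Finset V → k := fun F => if v ∈ F then 0 else eraseSign k v (insert v F) * c (insert v F)
  have he1 : ∀ F, v ∈ F → e F = 0 := fun F hF => if_pos hF
  have he2 : ∀ F, v ∉ F → e F = eraseSign k v (insert v F) * c (insert v F) :=
    fun F hF => if_neg hF
  refine ⟨e, ?_, ?_⟩
  · intro F hF
    by_cases hv : v ∈ F
    · exact absurd (he1 F hv) hF
    · rw [he2 F hv] at hF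
      obtain ⟨h1, h2⟩ := hc _ (right_ne_zero_of_mul hF)
      rw [h, Finset.erase_eq_of_notMem hv] at h1
      rw [Finset.card_insert_of_notMem hv] at h2
      exact ⟨h1, h2⟩
  · funext F
    rw [coboundary_apply]
    split_ifs with hF
    swap
    · by_contra h'
      exact hF (hc F (Ne.symm h')).1
    by_cases hv : v ∈ F
    · rw [Finset.sum_eq_single_of_mem v hv, he2 _ (Finset.notMem_erase v F), Finset.insert_erase hv,
        ← mul_assoc, eraseSign_mul_self, one_mul]
      intro w _ hw
      rw [he1 _ (Finset.mem_erase.2 ⟨Ne.symm hw, hv⟩), mul_zero]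
    -- For `v ∉ F`, the cocycle equation at `F ∪ {v}` expresses `c F` through the values of `c` on
    -- sets containing `v`, which are the values of `e` up to sign.
    · have h0 := congrFun hdc (insert v F)
      rw [coboundary_apply, if_pos (h.insert_mem hF), Pi.zero_apply, Finset.sum_insert hv,
        Finset.erase_insert hv] at h0
      have h1 : c F = -(eraseSign k v (insert v F) * ∑ w ∈ F, eraseSign k w (insert v F) *
          c ((insert v F).erase w)) := by
        have := congrArg (eraseSign k v (insert v F) * ·) h0
        simp only [mul_add, mul_zero, ← mul_assoc, eraseSign_mul_self, one_mul] at this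
        exact eq_neg_of_add_eq_zero_left this
      rw [h1, Finset.mul_sum, ← Finset.sum_neg_distrib]
      refine Finset.sum_congr rfl fun w hw => ?_
      have hwv : w ≠ v := fun e => hv (e ▸ hw)
      have h2 := eraseSign_mul_eraseSign k hwv.symm (Finset.mem_insert_self v F)
        (Finset.mem_insert_of_mem hw)
      rw [Finset.erase_insert hv, Finset.erase_insert_of_ne hwv.symm] at h2
      rw [he2 _ fun h' => hv (Finset.mem_of_mem_erase h'), Finset.erase_insert_of_ne hwv.symm,
        ← mul_assoc, ← mul_assoc, mul_comm (eraseSign k w F), h2, neg_mul]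

/-- The Euler characteristic of a family of finite sets. -/
def eulerChar (K : Finset (Finset V)) : ℤ := ∑ F ∈ K, (-1) ^ F.card

theorem ToggleInvariant.eulerChar_eq_zero {K : Finset (Finset V)} {v : V}
    (h : ToggleInvariant K v) : eulerChar K = 0 := by
  refine Finset.sum_involution (fun F _ => if v ∈ F then F.erase v else insert v F) ?_ ?_ ?_ ?_
  · intro F hF
    split_ifs with hv
    · rw [← Finset.card_erase_add_one hv, pow_succ]; ring
    · rw [Finset.card_insert_of_notMem hv, pow_succ]; ring
  · intro F hF _
    split_ifs with hv
    · intro h'; rw [← h'] at hv; simp at hv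
    · intro h'; rw [← h'] at hv; simp at hv
  · intro F hF
    split_ifs with hv
    · exact h.erase_mem hF
    · exact h.insert_mem hF
  · intro F hF
    by_cases hv : v ∈ F
    · simp [hv, Finset.insert_erase hv]
    · simp [hv, Finset.erase_insert hv]

/-- Cochains supported on the upper set `p` form a subcomplex whose quotient is the complex of the
lower part. As in the long exact sequence, a primitive on the lower part is found first, and the
error, which lives on the upper part, is then corrected. -/
theorem ExactAt.of_filter {K : Finset (Finset V)} (hK : (K : Set (Finset V)).OrdConnected)
    {p : Finset V → Prop} [DecidablePred p]
    (hp : ∀ E ∈ K, ∀ F ∈ K, E ⊆ F → p E → p F) {j : ℕ}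
    (h1 : ExactAt k (K.filter fun F => ¬ p F) j) (h2 : ExactAt k (K.filter p) j) :
    ExactAt k K j := by
  intro c hc hdc
  obtain ⟨e₁, he₁, hd₁⟩ := h1 (fun F => if p F then 0 else c F) (by
    intro F hF
    by_cases hpF : p F
    · simp [hpF] at hF
    · simp only [hpF, if_false] at hF
      simpa [hpF] using hc F hF) (by
    funext F
    rw [coboundary_apply, Pi.zero_apply]
    split_ifs with hF
    swap; · rfl
    rw [Finset.mem_filter] at hF
    have := congrFun hdc F
    rw [coboundary_apply, if_pos hF.1, Pi.zero_apply] at this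
    refine Eq.trans (Finset.sum_congr rfl fun v _ => ?_) this
    split_ifs with hpv
    · by_cases h0 : c (F.erase v) = 0
      · rw [h0]
      · exact absurd (hp _ (hc _ h0).1 _ hF.1 (Finset.erase_subset _ _) hpv) hF.2
    · rfl)
  have hK₁ : ∀ F, e₁ F ≠ 0 → F ∈ K := fun F hF => (Finset.mem_filter.1 (he₁ F hF).1).1
  have key : ∀ F, ¬ p F → coboundary k K e₁ F = c F := by
    intro F hF
    have := congrFun hd₁ F
    simp only [coboundary_apply, Finset.mem_filter, hF, not_false_eq_true, and_true,
      if_false] at this ⊢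
    exact this
  obtain ⟨e₂, he₂, hd₂⟩ := h2 (c - coboundary k K e₁) (by
    intro F hF
    by_cases hpF : p F
    · rw [Pi.sub_apply] at hF
      by_cases h0 : c F = 0
      · rw [h0, zero_sub, neg_ne_zero, coboundary_apply] at hF
        obtain ⟨hFK, hF⟩ := (ite_ne_right_iff).1 hF
        obtain ⟨v, hv, hne⟩ := Finset.exists_ne_zero_of_sum_ne_zero hF
        have := (he₁ _ (right_ne_zero_of_mul hne)).2
        rw [Finset.card_erase_add_one hv] at this
        exact ⟨Finset.mem_filter.2 ⟨hFK, hpF⟩, this⟩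
      · exact ⟨Finset.mem_filter.2 ⟨(hc F h0).1, hpF⟩, (hc F h0).2⟩
    · exact absurd (by rw [Pi.sub_apply, key F hpF, sub_self]) hF) (by
    have : coboundary k K (c - coboundary k K e₁) = 0 := by
      rw [map_sub, hdc, coboundary_coboundary hK fun F hF => by_contra fun h => hF (hK₁ F h),
        sub_zero]
    funext F
    have := congrFun this F
    rw [coboundary_apply, Pi.zero_apply] at this ⊢
    split_ifs with hF
    · rwa [if_pos (Finset.mem_filter.1 hF).1] at this
    · rfl)
  refine ⟨e₁ + e₂, ?_, ?_⟩
  · intro F hF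
    by_cases h0 : e₁ F = 0
    · rw [Pi.add_apply, h0, zero_add] at hF
      exact ⟨(Finset.mem_filter.1 (he₂ F hF).1).1, (he₂ F hF).2⟩
    · exact ⟨hK₁ F h0, (he₁ F h0).2⟩
  · have : coboundary k K e₂ = c - coboundary k K e₁ := by
      rw [← hd₂]
      funext F
      rw [coboundary_apply, coboundary_apply]
      by_cases hFK : F ∈ K
      · by_cases hpF : p F
        · simp [hFK, hpF]
        · rw [if_pos hFK, if_neg (by simp [hpF])]
          refine Finset.sum_eq_zero fun v _ => ?_
          by_cases h0 : e₂ (F.erase v) = 0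
          · rw [h0, mul_zero]
          · obtain ⟨ha, hb⟩ := Finset.mem_filter.1 (he₂ _ h0).1
            exact absurd (hp _ ha _ hFK (Finset.erase_subset _ _) hb) hpF
      · simp [hFK]
    rw [map_add, this, add_sub_cancel]

theorem eulerChar_filter_add (K : Finset (Finset V)) (p : Finset V → Prop) [DecidablePred p] :
    eulerChar (K.filter fun F => ¬ p F) + eulerChar (K.filter p) = eulerChar K := by
  rw [eulerChar, eulerChar, eulerChar, add_comm, Finset.sum_filter_add_sum_filter_not]

theorem exactAt_of_card {K : Finset (Finset V)} {j₀ : ℕ} (h : ∀ F ∈ K, F.card = j₀) {j : ℕ}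
    (hj : j ≠ j₀) : ExactAt k K j := by
  intro c hc _
  have : c = 0 := by
    funext F
    by_contra hF
    exact hj ((hc F hF).2.symm.trans (h F (hc F hF).1))
  exact ⟨0, by simp, by rw [this, map_zero]⟩

/-- Discrete Morse theory for a monotone map `r` on `K`, each of whose fibres is either stable
under toggling some element or concentrated in cardinality `j₀`. -/
theorem exactAt_and_eulerChar_of_monotone {P : Type*} [PartialOrder P] [DecidableEq P]
    (r : Finset V → P) (j₀ : ℕ) (crit : P → Prop) [DecidablePred crit] (K : Finset (Finset V))
    (hK : (K : Set (Finset V)).OrdConnected)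
    (hr : ∀ E ∈ K, ∀ F ∈ K, E ⊆ F → r E ≤ r F)
    (htog : ∀ p, ¬ crit p → ∃ v, ToggleInvariant (K.filter (r · = p)) v)
    (hcrit : ∀ F ∈ K, crit (r F) → F.card = j₀) :
    (∀ j, j ≠ j₀ → ExactAt k K j) ∧
      eulerChar K = (-1) ^ j₀ * (K.filter fun F => crit (r F)).card := by
  induction hm : (K.image r).card generalizing K with
  | zero =>
    rw [Finset.card_eq_zero, Finset.image_eq_empty] at hm
    subst hm
    exact ⟨fun j hj => exactAt_of_card (by simp) hj, by simp [eulerChar]⟩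
  | succ m ih =>
    have hne : (K.image r).Nonempty := by
      rw [← Finset.card_pos, hm]; omega
    -- The fibre over a maximal value of `r` is an upper set in `K`, so it can be split off and the
    -- induction applied to the rest.
    obtain ⟨p, hp⟩ := Finset.exists_maximal hne
    have hup : ∀ E ∈ K, ∀ F ∈ K, E ⊆ F → r E = p → r F = p := by
      intro E hE F hF hEF h
      have h1 := hr E hE F hF hEF
      rw [h] at h1
      exact le_antisymm (hp.2 (Finset.mem_image_of_mem r hF) h1) h1
    have himg : (K.filter fun F => ¬ r F = p).image r = (K.image r).erase p := by
      ext q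
      simp only [Finset.mem_image, Finset.mem_filter, Finset.mem_erase]
      constructor
      · rintro ⟨F, ⟨h1, h2⟩, rfl⟩
        exact ⟨h2, F, h1, rfl⟩
      · rintro ⟨h2, F, h1, rfl⟩
        exact ⟨F, ⟨h1, h2⟩, rfl⟩
    obtain ⟨ih1, ih2⟩ := ih (K.filter fun F => ¬ r F = p)
      ⟨by
        intro E hE G hG F hF
        simp only [Finset.coe_filter, Set.mem_ofPred_eq] at hE hG ⊢
        have hFK : F ∈ K := hK.out hE.1 hG.1 hF
        exact ⟨hFK, fun h => hG.2 (hup F hFK G hG.1 hF.2 h)⟩⟩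
      (fun E hE F hF => hr E (Finset.mem_filter.1 hE).1 F (Finset.mem_filter.1 hF).1)
      (by
        intro q hq
        by_cases hqp : q = p
        -- The fibre over `p` has been removed, so any vertex toggles the empty family; `htog` only
        -- supplies some vertex.
        · obtain ⟨v, -⟩ := htog q hq
          refine ⟨v, fun F => ?_⟩
          simp only [Finset.mem_filter, hqp]
          tauto
        · obtain ⟨v, hv⟩ := htog q hq
          refine ⟨v, ?_⟩
          have : (K.filter fun F => ¬ r F = p).filter (r · = q) = K.filter (r · = q) := by
            ext F
            simp only [Finset.mem_filter]
            constructor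
            · tauto
            · rintro ⟨h1, rfl⟩; exact ⟨⟨h1, hqp⟩, rfl⟩
          rwa [this])
      (fun F hF => hcrit F (Finset.mem_filter.1 hF).1)
      (by rw [himg, Finset.card_erase_of_mem hp.1, hm]; rfl)
    have hlast : (∀ j, j ≠ j₀ → ExactAt k (K.filter (r · = p)) j) ∧
        eulerChar (K.filter (r · = p)) =
          (-1) ^ j₀ * ((K.filter (r · = p)).filter fun F => crit (r F)).card := by
      by_cases hc : crit p
      · have h1 : ∀ F ∈ K.filter (r · = p), F.card = j₀ := fun F hF =>
          hcrit F (Finset.mem_filter.1 hF).1 ((Finset.mem_filter.1 hF).2 ▸ hc)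
        refine ⟨fun j hj => exactAt_of_card h1 hj, ?_⟩
        rw [eulerChar, Finset.sum_congr rfl fun F hF => by rw [h1 F hF], Finset.sum_const,
          nsmul_eq_mul, mul_comm]
        congr 3
        ext F
        simp only [Finset.mem_filter]
        constructor
        · rintro ⟨h1, h2⟩; exact ⟨⟨h1, h2⟩, h2 ▸ hc⟩
        · exact fun h => h.1
      · obtain ⟨v, hv⟩ := htog p hc
        refine ⟨fun j _ => hv.exactAt j, ?_⟩
        rw [hv.eulerChar_eq_zero, Finset.filter_eq_empty_iff.2]
        · simp
        · intro F hF h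
          rw [(Finset.mem_filter.1 hF).2] at h
          exact hc h
    refine ⟨fun j hj => ExactAt.of_filter hK hup (ih1 j hj) (hlast.1 j hj), ?_⟩
    rw [← eulerChar_filter_add K (r · = p), ih2, hlast.2, ← mul_add, ← Nat.cast_add,
      Finset.filter_filter, Finset.filter_filter]
    congr 2
    rw [← Finset.card_union_of_disjoint]
    · congr 1
      ext F
      simp only [Finset.mem_union, Finset.mem_filter]
      tauto
    · rw [Finset.disjoint_filter]
      tauto

/-! ### Cohomology of a convex family and the Euler–Poincaré formula -/

/-- The functions supported on `A`. -/
def supportedOn (k : Type*) [Field k] (A : Finset (Finset V)) : Submodule k (Finset V → k) where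
  carrier := {c | ∀ F ∉ A, c F = 0}
  zero_mem' := fun _ _ => rfl
  add_mem' := fun {c c'} h h' F hF => by rw [Pi.add_apply, h F hF, h' F hF, add_zero]
  smul_mem' := fun r c h F hF => by rw [Pi.smul_apply, h F hF, smul_zero]

theorem mem_supportedOn {A : Finset (Finset V)} {c : Finset V → k} :
    c ∈ supportedOn k A ↔ ∀ F, c F ≠ 0 → F ∈ A :=
  ⟨fun h F hF => by_contra fun h' => hF (h F h'), fun h F hF => by_contra fun h' => hF (h F h')⟩

theorem finrank_supportedOn (A : Finset (Finset V)) :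
    Module.finrank k (supportedOn k A) = A.card := by
  let f : supportedOn k A →ₗ[k] (A → k) :=
    (LinearMap.funLeft k k (Subtype.val : A → Finset V)) ∘ₗ (supportedOn k A).subtype
  have hf : Function.Bijective f := by
    constructor
    · rw [injective_iff_map_eq_zero]
      rintro ⟨c, hc⟩ h
      ext F
      by_cases hF : F ∈ A
      · exact congrFun h ⟨F, hF⟩
      · exact hc F hF
    · intro g
      refine ⟨⟨fun F => if h : F ∈ A then g ⟨F, h⟩ else 0, fun F hF => dif_neg hF⟩, ?_⟩
      funext F
      exact dif_pos F.2
  rw [(LinearEquiv.ofBijective f hf).finrank_eq, Module.finrank_fintype_fun_eq_card,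
    Fintype.card_coe]

/-- The degree `j` cocycles of the family `K`. -/
def cocycles (k : Type*) [Field k] (K : Finset (Finset V)) (j : ℕ) : Submodule k (Finset V → k) :=
  supportedOn k (K.filter (·.card = j)) ⊓ LinearMap.ker (coboundary k K)

/-- The degree `j` coboundaries of the family `K`. -/
def coboundaries (k : Type*) [Field k] (K : Finset (Finset V)) (j : ℕ) :
    Submodule k (Finset V → k) :=
  (supportedOn k (K.filter (·.card + 1 = j))).map (coboundary k K)

/-- The degree `j` cohomology of the family `K`. -/
def Cohomology (k : Type*) [Field k] (K : Finset (Finset V)) (j : ℕ) : Type _ :=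
  cocycles k K j ⧸ (coboundaries k K j).submoduleOf (cocycles k K j)

instance (K : Finset (Finset V)) (j : ℕ) : AddCommGroup (Cohomology k K j) :=
  Submodule.Quotient.addCommGroup _

instance (K : Finset (Finset V)) (j : ℕ) : Module k (Cohomology k K j) :=
  Submodule.Quotient.module _

instance [Finite V] (K : Finset (Finset V)) (j : ℕ) : Module.Finite k (Cohomology k K j) :=
  Module.Finite.quotient k ((coboundaries k K j).submoduleOf (cocycles k K j))

/-- The cohomology class of a cocycle. -/
def Cohomology.mk (K : Finset (Finset V)) (j : ℕ) : cocycles k K j →ₗ[k] Cohomology k K j :=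
  Submodule.mkQ _

theorem Cohomology.mk_surjective (K : Finset (Finset V)) (j : ℕ) :
    Function.Surjective (Cohomology.mk (k := k) K j) :=
  Submodule.mkQ_surjective _

theorem Cohomology.mk_eq_zero_iff {K : Finset (Finset V)} {j : ℕ} (c : cocycles k K j) :
    Cohomology.mk K j c = 0 ↔ c.1 ∈ coboundaries k K j :=
  Submodule.Quotient.mk_eq_zero _

theorem coboundary_mem_supportedOn (K : Finset (Finset V)) (j : ℕ) {c : Finset V → k}
    (hc : c ∈ supportedOn k (K.filter (·.card + 1 = j))) :
    coboundary k K c ∈ supportedOn k (K.filter (·.card = j)) := by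
  rw [mem_supportedOn] at hc ⊢
  intro F hF
  rw [coboundary_apply] at hF
  obtain ⟨hFK, hF⟩ := (ite_ne_right_iff).1 hF
  obtain ⟨v, hv, hne⟩ := Finset.exists_ne_zero_of_sum_ne_zero hF
  have := (Finset.mem_filter.1 (hc _ (right_ne_zero_of_mul hne))).2
  rw [Finset.card_erase_add_one hv] at this
  exact Finset.mem_filter.2 ⟨hFK, this⟩

theorem coboundaries_le_cocycles {K : Finset (Finset V)}
    (hK : (K : Set (Finset V)).OrdConnected) (j : ℕ) : coboundaries k K j ≤ cocycles k K j := by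
  rintro _ ⟨c, hc, rfl⟩
  refine ⟨coboundary_mem_supportedOn K j hc, ?_⟩
  exact coboundary_coboundary hK fun F hF =>
    hc F fun h => hF (Finset.mem_filter.1 h).1

theorem ExactAt.cocycles_eq {K : Finset (Finset V)} (hK : (K : Set (Finset V)).OrdConnected)
    {j : ℕ} (h : ExactAt k K j) : cocycles k K j = coboundaries k K j := by
  refine le_antisymm ?_ (coboundaries_le_cocycles hK j)
  rintro c ⟨hc, hdc⟩
  obtain ⟨e, he, hd⟩ := h c (fun F hF => Finset.mem_filter.1 (mem_supportedOn.1 hc F hF)) hdc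
  exact ⟨e, mem_supportedOn.2 fun F hF => Finset.mem_filter.2 (he F hF), hd⟩

variable [Fintype V]

/-- Rank–nullity for the coboundary on cochains of degree `j`. -/
theorem card_filter_eq_finrank (K : Finset (Finset V)) (j : ℕ) :
    (K.filter (·.card = j)).card =
      Module.finrank k (cocycles k K j) + Module.finrank k (coboundaries k K (j + 1)) := by
  have h := LinearMap.finrank_range_add_finrank_ker
    ((coboundary k K).domRestrict (supportedOn k (K.filter (·.card = j))))
  rw [finrank_supportedOn, LinearMap.range_domRestrict] at h
  have h1 : Module.finrank k (LinearMap.ker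
      ((coboundary k K).domRestrict (supportedOn k (K.filter (·.card = j))))) =
      Module.finrank k (cocycles k K j) := by
    rw [LinearMap.ker_domRestrict, cocycles, ← Submodule.map_comap_subtype]
    exact (Submodule.finrank_map_subtype_eq _ _).symm
  rw [h1] at h
  have h2 : coboundaries k K (j + 1) =
      (supportedOn k (K.filter (·.card = j))).map (coboundary k K) := by
    simp [coboundaries]
  rw [h2, ← h, add_comm]

theorem finrank_cohomology_add {K : Finset (Finset V)} (hK : (K : Set (Finset V)).OrdConnected)
    (j : ℕ) : Module.finrank k (Cohomology k K j) + Module.finrank k (coboundaries k K j) =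
      Module.finrank k (cocycles k K j) := by
  rw [← (Submodule.submoduleOfEquivOfLe (coboundaries_le_cocycles hK j)).finrank_eq]
  exact Submodule.finrank_quotient_add_finrank _

theorem ExactAt.finrank_cohomology {K : Finset (Finset V)}
    (hK : (K : Set (Finset V)).OrdConnected) {j : ℕ} (h : ExactAt k K j) :
    Module.finrank k (Cohomology k K j) = 0 := by
  have h1 := finrank_cohomology_add (k := k) hK j
  have h2 : Module.finrank k (cocycles k K j) = Module.finrank k (coboundaries k K j) := by
    rw [h.cocycles_eq hK]
  omega

theorem eulerChar_eq_sum_finrank {K : Finset (Finset V)}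
    (hK : (K : Set (Finset V)).OrdConnected) :
    eulerChar K = ∑ j ∈ Finset.range (Fintype.card V + 1),
      (-1) ^ j * (Module.finrank k (Cohomology k K j) : ℤ) := by
  have h1 : eulerChar K = ∑ j ∈ Finset.range (Fintype.card V + 1),
      (-1) ^ j * ((K.filter (·.card = j)).card : ℤ) := by
    rw [eulerChar, ← Finset.sum_fiberwise_of_maps_to (s := K) (g := Finset.card)
      (t := Finset.range (Fintype.card V + 1))
      (fun F _ => Finset.mem_range.2 (Nat.lt_succ_of_le (Finset.card_le_univ F)))]
    refine Finset.sum_congr rfl fun j _ => ?_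
    rw [Finset.sum_congr rfl fun F hF => by rw [(Finset.mem_filter.1 hF).2], Finset.sum_const,
      nsmul_eq_mul, mul_comm]
  -- The partial alternating sums differ only by the rank of the last coboundary map, which vanishes
  -- beyond degree `|V|`.
  have h2 : ∀ m, ∑ j ∈ Finset.range m, (-1) ^ j * ((K.filter (·.card = j)).card : ℤ) =
      ∑ j ∈ Finset.range m, (-1) ^ j * (Module.finrank k (Cohomology k K j) : ℤ) +
        (-1) ^ (m + 1) * (Module.finrank k (coboundaries k K m) : ℤ) := by
    intro m
    induction m with
    | zero =>
      have h0 : coboundaries k K 0 = ⊥ := by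
        have : supportedOn k (K.filter fun F => F.card + 1 = 0) = ⊥ := by
          rw [eq_bot_iff]
          intro c hc
          exact funext fun F => hc F (by simp)
        rw [coboundaries, this, Submodule.map_bot]
      rw [h0]; simp
    | succ m ih =>
      rw [Finset.sum_range_succ, Finset.sum_range_succ, ih, card_filter_eq_finrank (k := k),
        ← finrank_cohomology_add hK]
      push_cast
      ring
  have h3 : coboundaries k K (Fintype.card V + 1) ≤ ⊥ := by
    rintro _ ⟨c, hc, rfl⟩
    have := coboundary_mem_supportedOn K _ hc
    refine funext fun F => this F fun hF => ?_
    have := (Finset.mem_filter.1 hF).2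
    have := Finset.card_le_univ F
    omega
  rw [h1, h2, eq_bot_iff.2 h3]
  simp

/-- Since the cohomology vanishes outside degree `j₀`, the Euler characteristic has a single term
and counts the critical faces without examining the differential. -/
theorem finrank_cohomology_of_monotone {P : Type*} [PartialOrder P] [DecidableEq P]
    (r : Finset V → P) (j₀ : ℕ) (crit : P → Prop) [DecidablePred crit] (K : Finset (Finset V))
    (hK : (K : Set (Finset V)).OrdConnected)
    (hr : ∀ E ∈ K, ∀ F ∈ K, E ⊆ F → r E ≤ r F)
    (htog : ∀ p, ¬ crit p → ∃ v, ToggleInvariant (K.filter (r · = p)) v)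
    (hcrit : ∀ F ∈ K, crit (r F) → F.card = j₀) (j : ℕ) :
    Module.finrank k (Cohomology k K j) =
      if j = j₀ then (K.filter fun F => crit (r F)).card else 0 := by
  obtain ⟨h1, h2⟩ := exactAt_and_eulerChar_of_monotone (k := k) r j₀ crit K hK hr htog hcrit
  split_ifs with hj
  · subst hj
    rw [eulerChar_eq_sum_finrank (k := k) hK] at h2
    by_cases hjV : j ∈ Finset.range (Fintype.card V + 1)
    · rw [Finset.sum_eq_single_of_mem j hjV] at h2
      · have : ((-1 : ℤ) ^ j) ≠ 0 := by simp
        exact_mod_cast mul_left_cancel₀ this h2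
      · intro i _ hi
        rw [(h1 i hi).finrank_cohomology hK]; simp
    -- Here `j > |V|`, so no face has cardinality `j` and both sides vanish.
    · have hempty : ∀ p : Finset V → Prop, ∀ F ∈ K, p F → F.card ≠ j := by
        intro p F _ _ h
        rw [Finset.mem_range, ← h] at hjV
        have := Finset.card_le_univ F
        omega
      have h3 : K.filter (fun F => crit (r F)) = ∅ :=
        Finset.filter_eq_empty_iff.2 fun F hF h =>
          hempty (fun F => crit (r F)) F hF h (hcrit F hF h)
      have h4 : ExactAt k K j := by
        intro c hc _
        have : c = 0 := by
          funext F
          by_contra hF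
          exact hempty (fun _ => True) F (hc F hF).1 trivial (hc F hF).2
        exact ⟨0, by simp, by rw [this, map_zero]⟩
      rw [h3, h4.finrank_cohomology hK, Finset.card_empty]
  · exact (h1 j hj).finrank_cohomology hK

end

end SetFamily

/-! ### The multigraded structure of the Čech complex of an edge ideal -/


section MultigradedCech

variable {k : Type*} [Field k] {V : Type*} [Fintype V] [LinearOrder V]

/-- The exponent of the squarefree monomial `∏ v ∈ F, X v`. -/
def squarefreeExponent (F : Finset V) : V →₀ ℕ :=
  Finsupp.equivFunOnFinite.symm fun v => if v ∈ F then 1 else 0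

theorem squarefreeExponent_apply (F : Finset V) (v : V) :
    squarefreeExponent F v = if v ∈ F then 1 else 0 := rfl

theorem prod_X_pow_eq_monomial (F : Finset V) (s : ℕ) :
    (∏ v ∈ F, MvPolynomial.X v : MvPolynomial V k) ^ s =
      MvPolynomial.monomial (s • squarefreeExponent F) 1 := by
  have : (∏ v ∈ F, MvPolynomial.X v : MvPolynomial V k) =
      MvPolynomial.monomial (squarefreeExponent F) 1 := by
    rw [MvPolynomial.monomial_eq, MvPolynomial.C_1, one_mul, Finsupp.prod_fintype _ _ (by simp),
      ← Finset.prod_subset (Finset.subset_univ F)]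
    · exact Finset.prod_congr rfl fun v hv => by simp [squarefreeExponent_apply, hv]
    · intro v _ hv
      simp [squarefreeExponent_apply, hv]
  rw [this, MvPolynomial.monomial_pow, one_pow]

/-- The coefficient of `p` at an integral exponent vector, zero if an entry is negative. -/
def intCoeff (b : V → ℤ) : MvPolynomial V k →ₗ[k] k :=
  if ∀ v, 0 ≤ b v then
    MvPolynomial.lcoeff k (Finsupp.equivFunOnFinite.symm fun v => (b v).toNat)
  else 0

theorem intCoeff_of_nonneg {b : V → ℤ} (hb : ∀ v, 0 ≤ b v) (p : MvPolynomial V k) :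
    intCoeff b p = p.coeff (Finsupp.equivFunOnFinite.symm fun v => (b v).toNat) := by
  rw [intCoeff, if_pos hb, MvPolynomial.lcoeff_apply]

theorem intCoeff_of_neg {b : V → ℤ} {v : V} (hv : b v < 0) (p : MvPolynomial V k) :
    intCoeff b p = 0 := by
  rw [intCoeff, if_neg fun h => absurd (h v) (not_le.2 hv), LinearMap.zero_apply]

theorem intCoeff_natCast (m : V →₀ ℕ) (p : MvPolynomial V k) :
    intCoeff (fun v => (m v : ℤ)) p = p.coeff m := by
  rw [intCoeff_of_nonneg fun v => Int.natCast_nonneg _]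
  congr 1
  ext v
  simp

theorem intCoeff_mul_monomial (b : V → ℤ) (m : V →₀ ℕ) (p : MvPolynomial V k) :
    intCoeff (fun v => b v + m v) (p * MvPolynomial.monomial m 1) = intCoeff b p := by
  by_cases h1 : ∀ v, 0 ≤ b v
  · rw [intCoeff_of_nonneg h1, intCoeff_of_nonneg fun v => add_nonneg (h1 v) (Int.natCast_nonneg _),
      MvPolynomial.coeff_mul_monomial', mul_one, if_pos]
    · congr 1
      ext v
      have := h1 v
      simp only [Finsupp.coe_tsub, Pi.sub_apply, Finsupp.equivFunOnFinite_symm_apply_apply]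
      omega
    · intro v
      have := h1 v
      simp only [Finsupp.equivFunOnFinite_symm_apply_apply]
      omega
  · push Not at h1
    obtain ⟨v, hv⟩ := h1
    rw [intCoeff_of_neg hv]
    by_cases h2 : ∀ v, 0 ≤ b v + m v
    · rw [intCoeff_of_nonneg h2, MvPolynomial.coeff_mul_monomial', if_neg]
      intro h
      have := h v
      simp only [Finsupp.equivFunOnFinite_symm_apply_apply] at this
      have := h2 v
      omega
    · push Not at h2
      obtain ⟨w, hw⟩ := h2
      exact intCoeff_of_neg (b := fun v => b v + m v) (v := w) hw _

variable (G : SimpleGraph V)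

/-- A monomial with independent support is divisible by no generator `x_u x_v`. -/
theorem intCoeff_eq_zero_of_mem_edgeIdeal {b : V → ℤ}
    (hb : ∀ u v, G.Adj u v → b u ≠ 0 → b v = 0) {f : MvPolynomial V k} (hf : f ∈ edgeIdeal k G) :
    intCoeff b f = 0 := by
  -- The arbitrary multiplier `q` makes the claim stable under scalar multiplication in the span
  -- induction.
  suffices h : ∀ q, intCoeff b (q * f) = 0 by simpa using h 1
  rw [edgeIdeal] at hf
  induction hf using Submodule.span_induction with
  | mem x hx =>
    obtain ⟨u, v, huv, rfl⟩ := hx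
    intro q
    by_cases hn : ∀ v, 0 ≤ b v
    · rw [intCoeff_of_nonneg hn, ← mul_assoc, MvPolynomial.coeff_mul_X', MvPolynomial.coeff_mul_X']
      split_ifs with h1 h2
      · exfalso
        simp only [Finsupp.mem_support_iff, Finsupp.equivFunOnFinite_symm_apply_apply,
          Finsupp.coe_tsub, Pi.sub_apply] at h1 h2
        have := hb u v huv (by omega)
        omega
      · rfl
      · rfl
    · push Not at hn
      obtain ⟨w, hw⟩ := hn
      exact intCoeff_of_neg hw _
  | zero => simp
  | add x y _ _ hx hy => intro q; rw [mul_add, map_add, hx, hy, add_zero]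
  | smul r x _ hx => intro q; rw [smul_eq_mul, ← mul_assoc]; exact hx _

open Classical in
/-- The sets `F` for which `(S/I(G))_{x_F}` is nonzero in the multidegree `a`. -/
def degreeFamily (a : V → ℤ) : Finset (Finset V) :=
  Finset.univ.filter fun F => (∀ v, a v < 0 → v ∈ F) ∧
    ∀ u v, G.Adj u v → (a u ≠ 0 ∨ u ∈ F) → ¬ (a v ≠ 0 ∨ v ∈ F)

variable {G} in
theorem mem_degreeFamily {a : V → ℤ} {F : Finset V} :
    F ∈ degreeFamily G a ↔ (∀ v, a v < 0 → v ∈ F) ∧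
      ∀ u v, G.Adj u v → (a u ≠ 0 ∨ u ∈ F) → ¬ (a v ≠ 0 ∨ v ∈ F) := by
  simp [degreeFamily]

theorem degreeFamily_ordConnected (a : V → ℤ) :
    (degreeFamily G a : Set (Finset V)).OrdConnected := by
  refine ⟨fun E hE F hF D hD => ?_⟩
  rw [Finset.mem_coe, mem_degreeFamily] at *
  refine ⟨fun v hv => hD.1 (hE.1 v hv), fun u v huv h h' => hF.2 u v huv ?_ ?_⟩
  · exact h.imp_right fun h => hD.2 h
  · exact h'.imp_right fun h => hD.2 h

/-- A vertex with positive exponent already counts towards the support and is not forced into `F`,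
so neither condition sees whether `F` contains it. -/
theorem degreeFamily_toggleInvariant {a : V → ℤ} {v : V} (hv : 0 < a v) :
    SetFamily.ToggleInvariant (degreeFamily G a) v := by
  intro F
  rw [mem_degreeFamily, mem_degreeFamily]
  have h : ∀ u, (a u ≠ 0 ∨ u ∈ insert v F) ↔ (a u ≠ 0 ∨ u ∈ F.erase v) := by
    intro u
    by_cases huv : u = v
    · subst huv; simp [hv.ne']
    · simp [huv]
  simp only [h]
  refine and_congr_left fun _ => forall_congr' fun u => imp_congr_right fun hu => ?_
  have huv : u ≠ v := by rintro rfl; omega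
  simp [huv]

/-! ### Coefficients of elements of the localizations -/

/-- `z` is the fraction `p / x_F ^ s`. -/
def IsFraction (F : Finset V) (z : CechLoc (edgeIdeal k G) F) (s : ℕ) (p : MvPolynomial V k) :
    Prop :=
  z * algebraMap _ (CechLoc (edgeIdeal k G) F) (varProd (edgeIdeal k G) F ^ s) =
    algebraMap _ (CechLoc (edgeIdeal k G) F) (Ideal.Quotient.mk (edgeIdeal k G) p)

variable {G}

theorem varProd_pow (I : Ideal (MvPolynomial V k)) (F : Finset V) (s : ℕ) :
    varProd I F ^ s =
      Ideal.Quotient.mk I (MvPolynomial.monomial (s • squarefreeExponent F) 1) := by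
  rw [varProd, ← map_pow, prod_X_pow_eq_monomial]

theorem exists_isFraction (F : Finset V) (z : CechLoc (edgeIdeal k G) F) :
    ∃ s p, IsFraction G F z s p := by
  obtain ⟨s, q, h⟩ := IsLocalization.Away.surj (varProd (edgeIdeal k G) F) z
  obtain ⟨p, rfl⟩ := Ideal.Quotient.mk_surjective q
  exact ⟨s, p, by rw [IsFraction, map_pow, h]⟩

theorem IsFraction.mul_pow {F : Finset V} {z : CechLoc (edgeIdeal k G) F} {s : ℕ}
    {p : MvPolynomial V k} (h : IsFraction G F z s p) (t : ℕ) :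
    IsFraction G F z (s + t) (p * MvPolynomial.monomial (t • squarefreeExponent F) 1) := by
  rw [IsFraction] at *
  rw [map_mul (Ideal.Quotient.mk _), ← varProd_pow, map_mul, ← h, pow_add, map_mul, mul_assoc]

theorem IsFraction.add {F : Finset V} {z w : CechLoc (edgeIdeal k G) F} {s : ℕ}
    {p q : MvPolynomial V k} (h : IsFraction G F z s p) (h' : IsFraction G F w s q) :
    IsFraction G F (z + w) s (p + q) := by
  rw [IsFraction] at *
  rw [add_mul, h, h', map_add, map_add]

theorem IsFraction.smul {F : Finset V} {z : CechLoc (edgeIdeal k G) F} {s : ℕ}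
    {p : MvPolynomial V k} (h : IsFraction G F z s p) (r : k) :
    IsFraction G F (r • z) s (r • p) := by
  rw [IsFraction] at *
  have h1 : Ideal.Quotient.mk (edgeIdeal k G) (r • p) = r • Ideal.Quotient.mk _ p := rfl
  rw [smul_mul_assoc, h, h1]
  exact (map_smul (IsScalarTower.toAlgHom k (MvPolynomial V k ⧸ edgeIdeal k G)
    (CechLoc (edgeIdeal k G) F)) r _).symm

theorem exists_isFraction_of (F : Finset V) (s : ℕ) (p : MvPolynomial V k) :
    ∃ z, IsFraction G F z s p := by
  have h : IsUnit (algebraMap _ (CechLoc (edgeIdeal k G) F) (varProd (edgeIdeal k G) F ^ s)) := by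
    rw [map_pow]
    exact (IsLocalization.Away.algebraMap_isUnit _).pow s
  obtain ⟨u, hu⟩ := h
  refine ⟨algebraMap _ _ (Ideal.Quotient.mk (edgeIdeal k G) p) * ↑u⁻¹, ?_⟩
  rw [IsFraction, ← hu, mul_assoc, Units.inv_mul, mul_one]

/-- The exponent vector of `x^a * x_F ^ s`. -/
def shiftExponent (a : V → ℤ) (F : Finset V) (s : ℕ) : V → ℤ :=
  fun v => a v + (s • squarefreeExponent F) v

theorem shiftExponent_apply (a : V → ℤ) (F : Finset V) (s : ℕ) (v : V) :
    shiftExponent a F s v = a v + if v ∈ F then (s : ℤ) else 0 := by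
  rw [shiftExponent, Finsupp.smul_apply, squarefreeExponent_apply]
  split_ifs <;> simp

theorem shiftExponent_add (a : V → ℤ) (F : Finset V) (s t : ℕ) :
    shiftExponent a F (s + t) = fun v => shiftExponent a F s v + (t • squarefreeExponent F) v := by
  funext v
  simp only [shiftExponent, add_smul, Finsupp.add_apply]
  push_cast
  ring

theorem shiftExponent_indep {a : V → ℤ} {F : Finset V} (hF : F ∈ degreeFamily G a) (s : ℕ) :
    ∀ u v, G.Adj u v → shiftExponent a F s u ≠ 0 → shiftExponent a F s v = 0 := by
  have key : ∀ v, shiftExponent a F s v ≠ 0 → (a v ≠ 0 ∨ v ∈ F) := by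
    intro v hv
    by_contra h
    push Not at h
    rw [shiftExponent_apply, h.1, if_neg h.2] at hv
    exact hv rfl
  intro u v huv hu
  by_contra hv
  exact (mem_degreeFamily.1 hF).2 u v huv (key u hu) (key v hv)

/-- Two numerators of one fraction agree modulo the ideal after multiplication by powers of `x_F`.
This only shifts exponents, and the shifted exponent has independent support, where elements of the
ideal have coefficient zero. -/
theorem IsFraction.intCoeff_eq {F : Finset V} {z : CechLoc (edgeIdeal k G) F} {s t : ℕ}
    {p q : MvPolynomial V k} (h : IsFraction G F z s p) (h' : IsFraction G F z t q) {a : V → ℤ}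
    (hF : F ∈ degreeFamily G a) :
    intCoeff (shiftExponent a F s) p = intCoeff (shiftExponent a F t) q := by
  have h1 := h.mul_pow t
  have h2 := h'.mul_pow s
  rw [add_comm t s] at h2
  have h3 := Eq.trans (Eq.symm h1) h2
  rw [IsLocalization.eq_iff_exists (Submonoid.powers (varProd (edgeIdeal k G) F))] at h3
  obtain ⟨⟨_, n, rfl⟩, hc⟩ := h3
  simp only at hc
  rw [varProd_pow, ← map_mul, ← map_mul, Ideal.Quotient.eq] at hc
  have h4 := intCoeff_eq_zero_of_mem_edgeIdeal G (shiftExponent_indep hF (s + t + n)) hc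
  rw [map_sub, sub_eq_zero, mul_comm, mul_comm (MvPolynomial.monomial _ _), shiftExponent_add _ _ _ n,
    intCoeff_mul_monomial, intCoeff_mul_monomial] at h4
  rw [shiftExponent_add, intCoeff_mul_monomial, ← shiftExponent_add, add_comm s t,
    shiftExponent_add, intCoeff_mul_monomial] at h4
  exact h4

open Classical in
/-- The coefficient of `x^a` in an element of `(S/I(G))_{x_F}`. -/
def locCoeff (F : Finset V) (a : V → ℤ) : CechLoc (edgeIdeal k G) F →ₗ[k] k where
  toFun z := if F ∈ degreeFamily G a then
    intCoeff (shiftExponent a F (exists_isFraction F z).choose)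
      (exists_isFraction F z).choose_spec.choose else 0
  map_add' z w := by
    split_ifs with hF
    swap; · simp
    have hz := (exists_isFraction F z).choose_spec.choose_spec
    have hw := (exists_isFraction F w).choose_spec.choose_spec
    have hzw := (exists_isFraction F (z + w)).choose_spec.choose_spec
    have h1 := hz.mul_pow (exists_isFraction F w).choose
    have h2 := hw.mul_pow (exists_isFraction F z).choose
    rw [hz.intCoeff_eq h1 hF, hw.intCoeff_eq h2 hF]
    rw [add_comm] at h2
    rw [add_comm (exists_isFraction F w).choose, hzw.intCoeff_eq (h1.add h2) hF, map_add]
  map_smul' r z := by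
    split_ifs with hF
    swap; · simp
    have hz := (exists_isFraction F z).choose_spec.choose_spec
    have hw := (exists_isFraction F (r • z)).choose_spec.choose_spec
    rw [hw.intCoeff_eq (hz.smul r) hF, map_smul, RingHom.id_apply]

theorem locCoeff_of_notMem {F : Finset V} {a : V → ℤ} (hF : F ∉ degreeFamily G a)
    (z : CechLoc (edgeIdeal k G) F) : locCoeff F a z = 0 := if_neg hF

theorem IsFraction.locCoeff_eq {F : Finset V} {z : CechLoc (edgeIdeal k G) F} {s : ℕ}
    {p : MvPolynomial V k} (h : IsFraction G F z s p) {a : V → ℤ} (hF : F ∈ degreeFamily G a) :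
    locCoeff F a z = intCoeff (shiftExponent a F s) p :=
  (if_pos hF).trans ((exists_isFraction F z).choose_spec.choose_spec.intCoeff_eq h hF)

theorem IsFraction.cechRes {E F : Finset V} (hEF : E ⊆ F) {z : CechLoc (edgeIdeal k G) E} {s : ℕ}
    {p : MvPolynomial V k} (h : IsFraction G E z s p) :
    IsFraction G F (cechRes (edgeIdeal k G) hEF z) s
      (p * MvPolynomial.monomial (s • squarefreeExponent (F \ E)) 1) := by
  have key : ∀ x : MvPolynomial V k ⧸ edgeIdeal k G,
      _root_.cechRes (edgeIdeal k G) hEF (algebraMap _ _ x) = algebraMap _ _ x := by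
    intro x
    exact IsLocalization.Away.lift_eq _ (isUnit_varProd_of_subset (edgeIdeal k G) hEF) x
  have h1 := congrArg (_root_.cechRes (edgeIdeal k G) hEF) h
  rw [map_mul, key, key] at h1
  rw [IsFraction, map_mul (Ideal.Quotient.mk _), ← varProd_pow, map_mul, ← h1, mul_assoc, ← map_mul,
    ← _root_.mul_pow]
  congr 3
  rw [varProd, varProd, varProd, ← map_mul, mul_comm (∏ v ∈ E, _), Finset.prod_sdiff hEF]

theorem locCoeff_cechRes {E F : Finset V} (hEF : E ⊆ F) {a : V → ℤ} (hF : F ∈ degreeFamily G a)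
    (z : CechLoc (edgeIdeal k G) E) :
    locCoeff F a (cechRes (edgeIdeal k G) hEF z) = locCoeff E a z := by
  obtain ⟨s, p, h⟩ := exists_isFraction E z
  rw [(h.cechRes hEF).locCoeff_eq hF]
  have h1 : shiftExponent a F s =
      fun v => shiftExponent a E s v + (s • squarefreeExponent (F \ E)) v := by
    funext v
    rw [shiftExponent_apply, shiftExponent_apply, Finsupp.smul_apply, squarefreeExponent_apply]
    by_cases h1 : v ∈ E
    · simp [h1, hEF h1]
    · by_cases h2 : v ∈ F <;> simp [h1, h2]
  rw [h1, intCoeff_mul_monomial]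
  by_cases hE : E ∈ degreeFamily G a
  · rw [h.locCoeff_eq hE]
  · rw [locCoeff_of_notMem hE]
    -- Independence passes from `F` to `E`, so `E` can only fail by missing some `v` with `a v < 0`.
    -- The exponent at `v` then stays negative and the coefficient is zero.
    rw [mem_degreeFamily] at hE hF
    have : ∃ v, a v < 0 ∧ v ∉ E := by
      by_contra hcon
      push Not at hcon
      exact hE ⟨hcon, fun u v huv hu hv =>
        hF.2 u v huv (hu.imp_right fun h => hEF h) (hv.imp_right fun h => hEF h)⟩
    obtain ⟨v, hv, hvE⟩ := this
    refine intCoeff_of_neg (v := v) ?_ _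
    rw [shiftExponent_apply, if_neg hvE, add_zero]
    exact hv

theorem monomial_mem_edgeIdeal {m : V →₀ ℕ} {u v : V} (huv : G.Adj u v) (hu : m u ≠ 0)
    (hv : m v ≠ 0) (r : k) : MvPolynomial.monomial m r ∈ edgeIdeal k G := by
  have h1 : (MvPolynomial.X u * MvPolynomial.X v : MvPolynomial V k) ∈ edgeIdeal k G :=
    Ideal.subset_span ⟨u, v, huv, rfl⟩
  have h2 : MvPolynomial.monomial m r = MvPolynomial.monomial
      (m - (Finsupp.single u 1 + Finsupp.single v 1)) r *
        (MvPolynomial.X u * MvPolynomial.X v : MvPolynomial V k) := by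
    rw [MvPolynomial.X, MvPolynomial.X, MvPolynomial.monomial_mul, MvPolynomial.monomial_mul,
      mul_one, mul_one, tsub_add_cancel_of_le]
    intro w
    have hne := huv.ne
    simp only [Finsupp.add_apply, Finsupp.single_apply]
    split_ifs with h1 h2 h2
    · exact absurd (h1.trans h2.symm) hne
    · subst h1; omega
    · subst h2; omega
    · omega
  rw [h2]
  exact Ideal.mul_mem_left _ _ h1

/-- Every monomial of the numerator has a multidegree in which the localization vanishes, so the
failing condition must be independence. One more factor `x_F` makes all of `F` occur in the
monomial, which puts it in the edge ideal. -/
theorem eq_zero_of_locCoeff_eq_zero {F : Finset V} {z : CechLoc (edgeIdeal k G) F}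
    (hz : ∀ a, locCoeff F a z = 0) : z = 0 := by
  obtain ⟨s, p, h⟩ := exists_isFraction F z
  have hmem : p * MvPolynomial.monomial (1 • squarefreeExponent F) 1 ∈ edgeIdeal k G := by
    rw [p.as_sum, Finset.sum_mul]
    refine Ideal.sum_mem _ fun m hm => ?_
    rw [MvPolynomial.monomial_mul, one_smul]
    let a : V → ℤ := fun v => m v - (s • squarefreeExponent F) v
    have ha : shiftExponent a F s = fun v => (m v : ℤ) := by
      funext v; simp [shiftExponent, a]
    have hne : F ∉ degreeFamily G a := by
      intro hF
      have := hz a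
      rw [h.locCoeff_eq hF, ha, intCoeff_natCast] at this
      exact MvPolynomial.mem_support_iff.1 hm this
    rw [mem_degreeFamily, not_and] at hne
    have hneg : ∀ v, a v < 0 → v ∈ F := by
      intro v hv
      by_contra hvF
      simp [a, squarefreeExponent_apply, hvF] at hv
      omega
    have := hne hneg
    push Not at this
    obtain ⟨u, v, huv, hu, hv⟩ := this
    have key : ∀ v, (a v ≠ 0 ∨ v ∈ F) → (m + squarefreeExponent F) v ≠ 0 := by
      intro v hv
      rw [Finsupp.add_apply, squarefreeExponent_apply]
      by_cases hvF : v ∈ F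
      · simp [hvF]
      · simp only [hvF, or_false] at hv
        simpa [a, squarefreeExponent_apply, hvF] using hv
    exact monomial_mem_edgeIdeal huv (key u hu) (key v hv) _
  have h1 := h.mul_pow 1
  rw [IsFraction, Ideal.Quotient.eq_zero_iff_mem.2 hmem, map_zero, map_pow] at h1
  exact (((IsLocalization.Away.algebraMap_isUnit
    (varProd (edgeIdeal k G) F)).pow _).mul_left_eq_zero).1 h1

theorem sum_shiftExponent (a : V → ℤ) (F : Finset V) (s : ℕ) :
    ∑ v, shiftExponent a F s v = ∑ v, a v + s * F.card := by
  simp only [shiftExponent_apply]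
  rw [Finset.sum_add_distrib, Finset.sum_ite_mem, Finset.univ_inter, Finset.sum_const,
    nsmul_eq_mul, mul_comm]

theorem exists_locCoeff_eq (F : Finset V) {a : V → ℤ} (hF : F ∈ degreeFamily G a) :
    ∃ z ∈ cechLocDegree (edgeIdeal k G) F (∑ v, a v),
      ∀ b, locCoeff F b z = if b = a then 1 else 0 := by
  -- Any power of `x_F` large enough to clear all negative entries of `a` would do.
  let s : ℕ := ∑ v, (a v).natAbs
  have hs : ∀ v, 0 ≤ shiftExponent a F s v := by
    intro v
    rw [shiftExponent_apply]
    have h1 : (a v).natAbs ≤ s :=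
      Finset.single_le_sum (f := fun v => (a v).natAbs) (fun _ _ => Nat.zero_le _)
        (Finset.mem_univ v)
    by_cases h : a v < 0
    · rw [if_pos ((mem_degreeFamily.1 hF).1 v h)]; omega
    · split_ifs <;> omega
  let m : V →₀ ℕ := Finsupp.equivFunOnFinite.symm fun v => (shiftExponent a F s v).toNat
  have hm : ∀ v, (m v : ℤ) = shiftExponent a F s v := fun v => Int.toNat_of_nonneg (hs v)
  obtain ⟨z, hz⟩ := exists_isFraction_of (G := G) F s (MvPolynomial.monomial m (1 : k))
  refine ⟨z, ⟨s, _, ?_, hz⟩, fun b => ?_⟩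
  · intro c hc
    have : c = m := by
      have := MvPolynomial.support_monomial_subset hc
      simpa using this
    rw [this, ← sum_shiftExponent, ← Finset.sum_congr rfl fun v _ => hm v, Finsupp.degree_eq_sum]
    push_cast
    rfl
  · by_cases hb : F ∈ degreeFamily G b
    · rw [hz.locCoeff_eq hb]
      by_cases hab : b = a
      · subst hab
        rw [if_pos rfl, intCoeff_of_nonneg hs, MvPolynomial.coeff_monomial, if_pos rfl]
      · rw [if_neg hab]
        by_cases hn : ∀ v, 0 ≤ shiftExponent b F s v
        · rw [intCoeff_of_nonneg hn, MvPolynomial.coeff_monomial, if_neg]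
          intro h
          refine hab (funext fun v => ?_)
          have h1 := congrArg (fun f : V →₀ ℕ => (f v : ℤ)) h
          simp only [hm, Finsupp.equivFunOnFinite_symm_apply_apply,
            Int.toNat_of_nonneg (hn v)] at h1
          rw [shiftExponent_apply, shiftExponent_apply] at h1
          omega
        · push Not at hn
          obtain ⟨w, hw⟩ := hn
          exact intCoeff_of_neg hw _
    · rw [locCoeff_of_notMem hb, if_neg]
      rintro rfl
      exact hb hF

theorem finite_locCoeff_ne_zero (F : Finset V) (z : CechLoc (edgeIdeal k G) F) :
    {a | locCoeff F a z ≠ 0}.Finite := by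
  obtain ⟨s, p, h⟩ := exists_isFraction F z
  refine (p.support.finite_toSet.image fun m v => (m v : ℤ) - (s • squarefreeExponent F) v).subset ?_
  intro a ha
  have hF : F ∈ degreeFamily G a := by
    by_contra hF
    exact ha (locCoeff_of_notMem hF z)
  have ha : locCoeff F a z ≠ 0 := ha
  rw [h.locCoeff_eq hF] at ha
  by_cases hn : ∀ v, 0 ≤ shiftExponent a F s v
  · rw [intCoeff_of_nonneg hn] at ha
    refine ⟨_, MvPolynomial.mem_support_iff.2 ha, ?_⟩
    funext v
    simp only [Finsupp.equivFunOnFinite_symm_apply_apply, Int.toNat_of_nonneg (hn v)]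
    simp [shiftExponent]
  · push Not at hn
    obtain ⟨w, hw⟩ := hn
    exact absurd (intCoeff_of_neg hw p) ha

theorem locCoeff_eq_zero_of_mem_cechLocDegree {F : Finset V} {z : CechLoc (edgeIdeal k G) F} {ℓ : ℤ}
    (hz : z ∈ cechLocDegree (edgeIdeal k G) F ℓ) {a : V → ℤ} (ha : ∑ v, a v ≠ ℓ) :
    locCoeff F a z = 0 := by
  obtain ⟨s, p, hp, h⟩ := hz
  have h : IsFraction G F z s p := h
  by_cases hF : F ∈ degreeFamily G a
  · rw [h.locCoeff_eq hF]
    by_cases hn : ∀ v, 0 ≤ shiftExponent a F s v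
    · rw [intCoeff_of_nonneg hn]
      by_contra h0
      have h1 := hp _ (MvPolynomial.mem_support_iff.2 h0)
      rw [Finsupp.degree_eq_sum] at h1
      push_cast at h1
      simp only [Finsupp.equivFunOnFinite_symm_apply_apply, Int.toNat_of_nonneg (hn _)] at h1
      rw [sum_shiftExponent] at h1
      exact ha (by linarith)
    · push Not at hn
      obtain ⟨w, hw⟩ := hn
      exact intCoeff_of_neg hw p
  · exact locCoeff_of_notMem hF z

theorem exists_locCoeff_eq_sum (F : Finset V) (Ω : Finset (V → ℤ)) (g : (V → ℤ) → k)
    (hg : ∀ a ∈ Ω, g a ≠ 0 → F ∈ degreeFamily G a) :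
    ∃ z : CechLoc (edgeIdeal k G) F,
      (∀ b, locCoeff F b z = if b ∈ Ω then g b else 0) ∧
      ∀ ℓ, (∀ a ∈ Ω, g a ≠ 0 → ∑ v, a v = ℓ) → z ∈ cechLocDegree (edgeIdeal k G) F ℓ := by
  induction Ω using Finset.induction_on with
  | empty => exact ⟨0, by simp, fun ℓ _ => zero_mem _⟩
  | insert a Ω ha ih =>
    obtain ⟨z, hz, hzd⟩ := ih fun b hb => hg b (Finset.mem_insert_of_mem hb)
    by_cases h0 : g a = 0
    · refine ⟨z, fun b => ?_, fun ℓ h => hzd ℓ fun b hb => h b (Finset.mem_insert_of_mem hb)⟩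
      rw [hz]
      by_cases hb : b = a
      · subst hb; simp [ha, h0]
      · simp [hb]
    · obtain ⟨w, hwd, hw⟩ := exists_locCoeff_eq (k := k) F (hg a (Finset.mem_insert_self _ _) h0)
      refine ⟨g a • w + z, fun b => ?_, fun ℓ h => ?_⟩
      · rw [map_add, map_smul, hw, hz]
        by_cases hb : b = a
        · subst hb; simp [ha]
        · simp [hb]
      · refine add_mem (Submodule.smul_mem _ _ ?_)
          (hzd ℓ fun b hb => h b (Finset.mem_insert_of_mem hb))
        rwa [← h a (Finset.mem_insert_self _ _) h0]

/-- An element is the sum of its finitely many multigraded components, since all its coefficients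
determine it. -/
theorem mem_cechLocDegree_iff {F : Finset V} {z : CechLoc (edgeIdeal k G) F} {ℓ : ℤ} :
    z ∈ cechLocDegree (edgeIdeal k G) F ℓ ↔ ∀ a, ∑ v, a v ≠ ℓ → locCoeff F a z = 0 := by
  refine ⟨fun hz a ha => locCoeff_eq_zero_of_mem_cechLocDegree hz ha, fun h => ?_⟩
  obtain ⟨w, hw, hwd⟩ := exists_locCoeff_eq_sum F (finite_locCoeff_ne_zero F z).toFinset
    (fun a => locCoeff F a z) fun a _ ha => by
      by_contra hF
      exact ha (locCoeff_of_notMem hF z)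
  have : z - w = 0 := by
    refine eq_zero_of_locCoeff_eq_zero fun a => ?_
    rw [map_sub, hw]
    split_ifs with ha
    · rw [sub_self]
    · rw [sub_zero]
      simpa using ha
  rw [sub_eq_zero.1 this]
  exact hwd ℓ fun a _ ha => by_contra fun h' => ha (h a h')

end MultigradedCech

/-! ### Multigraded decomposition of local cohomology -/

section CochainDecomposition

theorem nonempty_quotient_equiv_of_ker_eq {k M N : Type*} [Field k] [AddCommGroup M] [Module k M]
    [AddCommGroup N] [Module k N] {Z B : Submodule k M} (f : Z →ₗ[k] N)
    (hf : Function.Surjective f) (h : LinearMap.ker f = B.submoduleOf Z) :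
    Nonempty ((Z ⧸ B.submoduleOf Z) ≃ₗ[k] N) := by
  rw [← h]
  exact ⟨f.quotKerEquivOfSurjective hf⟩

variable {k : Type*} [Field k] {V : Type*} [Fintype V] [LinearOrder V] {G : SimpleGraph V}

/-- The component in the multidegree `a` of a Čech cochain. -/
def cochainCoeff (j : ℕ) (a : V → ℤ) : CechCochain (edgeIdeal k G) j →ₗ[k] (Finset V → k) :=
  LinearMap.pi fun F => if h : F.card = j then
    locCoeff F a ∘ₗ LinearMap.proj (R := k)
      (φ := fun E : {E : Finset V // E.card = j} => CechLoc (edgeIdeal k G) E.1) ⟨F, h⟩ else 0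

theorem cochainCoeff_apply {j : ℕ} (a : V → ℤ) (c : CechCochain (edgeIdeal k G) j)
    (F : {F : Finset V // F.card = j}) : cochainCoeff j a c F.1 = locCoeff F.1 a (c F) := by
  rw [cochainCoeff, LinearMap.pi_apply, dif_pos F.2]
  rfl

theorem cochainCoeff_of_card_ne {j : ℕ} (a : V → ℤ) (c : CechCochain (edgeIdeal k G) j)
    {F : Finset V} (hF : F.card ≠ j) : cochainCoeff j a c F = 0 := by
  rw [cochainCoeff, LinearMap.pi_apply, dif_neg hF]
  rfl

theorem cochainCoeff_mem_supportedOn (j : ℕ) (a : V → ℤ) (c : CechCochain (edgeIdeal k G) j) :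
    cochainCoeff j a c ∈ SetFamily.supportedOn k ((degreeFamily G a).filter (·.card = j)) := by
  intro F hF
  by_cases h : F.card = j
  · rw [cochainCoeff_apply a c ⟨F, h⟩]
    exact locCoeff_of_notMem (fun h' => hF (Finset.mem_filter.2 ⟨h', h⟩)) _
  · exact cochainCoeff_of_card_ne a c h

theorem cochainCoeff_cechDiff (j : ℕ) (a : V → ℤ) (c : CechCochain (edgeIdeal k G) j) :
    cochainCoeff (j + 1) a (cechDiff (edgeIdeal k G) j c) =
      SetFamily.coboundary k (degreeFamily G a) (cochainCoeff j a c) := by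
  funext F
  by_cases hj : F.card = j + 1
  · rw [cochainCoeff_apply a _ ⟨F, hj⟩, SetFamily.coboundary_apply]
    split_ifs with hF
    · rw [cechDiff, LinearMap.pi_apply, LinearMap.sum_apply, map_sum,
        ← Finset.sum_coe_sort F fun v => SetFamily.eraseSign k v F *
          cochainCoeff j a c (F.erase v)]
      refine Finset.sum_congr rfl fun v _ => ?_
      rw [LinearMap.smul_apply, map_smul, smul_eq_mul, LinearMap.comp_apply,
        AlgHom.toLinearMap_apply, locCoeff_cechRes _ hF, LinearMap.proj_apply,
        cochainCoeff_apply a c ⟨F.erase v, _⟩]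
      rfl
    · exact locCoeff_of_notMem hF _
  · rw [cochainCoeff_of_card_ne a _ hj, SetFamily.coboundary_apply]
    split_ifs with hF
    · refine (Finset.sum_eq_zero fun v hv => ?_).symm
      rw [cochainCoeff_of_card_ne a c, mul_zero]
      intro h
      rw [← h, Finset.card_erase_add_one hv] at hj
      exact hj rfl
    · rfl

theorem eq_zero_of_cochainCoeff_eq_zero {j : ℕ} {c : CechCochain (edgeIdeal k G) j}
    (h : ∀ a, cochainCoeff j a c = 0) : c = 0 := by
  funext F
  refine eq_zero_of_locCoeff_eq_zero fun a => ?_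
  rw [← cochainCoeff_apply, h, Pi.zero_apply]

theorem mem_cechCochainDegree_iff {j : ℕ} {c : CechCochain (edgeIdeal k G) j} {ℓ : ℤ} :
    c ∈ cechCochainDegree (edgeIdeal k G) j ℓ ↔ ∀ a, ∑ v, a v ≠ ℓ → cochainCoeff j a c = 0 := by
  rw [cechCochainDegree, Submodule.mem_pi]
  constructor
  · intro h a ha
    funext F
    by_cases hF : F.card = j
    · rw [cochainCoeff_apply a c ⟨F, hF⟩]
      exact mem_cechLocDegree_iff.1 (h ⟨F, hF⟩ trivial) a ha
    · exact cochainCoeff_of_card_ne a c hF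
  · intro h F _
    refine mem_cechLocDegree_iff.2 fun a ha => ?_
    rw [← cochainCoeff_apply, h a ha, Pi.zero_apply]

theorem finite_cochainCoeff_ne_zero (j : ℕ) (c : CechCochain (edgeIdeal k G) j) :
    {a | cochainCoeff j a c ≠ 0}.Finite := by
  have h : (⋃ F : {F : Finset V // F.card = j}, {a | locCoeff F.1 a (c F) ≠ 0}).Finite :=
    Set.finite_iUnion fun F => finite_locCoeff_ne_zero F.1 (c F)
  refine h.subset fun a ha => ?_
  by_contra hcon
  refine ha (funext fun F => ?_)
  by_cases hF : F.card = j
  · rw [cochainCoeff_apply a c ⟨F, hF⟩, Pi.zero_apply]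
    by_contra h
    exact hcon (Set.mem_iUnion.2 ⟨⟨F, hF⟩, h⟩)
  · exact cochainCoeff_of_card_ne a c hF

theorem exists_cochainCoeff_eq (j : ℕ) (Ω : Finset (V → ℤ)) (g : (V → ℤ) → Finset V → k)
    (hg : ∀ a ∈ Ω, g a ∈ SetFamily.supportedOn k ((degreeFamily G a).filter (·.card = j))) :
    ∃ c : CechCochain (edgeIdeal k G) j, ∀ a, cochainCoeff j a c = if a ∈ Ω then g a else 0 := by
  have h : ∀ F : {F : Finset V // F.card = j}, ∃ z : CechLoc (edgeIdeal k G) F.1,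
      ∀ a, locCoeff F.1 a z = if a ∈ Ω then g a F.1 else 0 := fun F => by
    obtain ⟨z, hz, -⟩ := exists_locCoeff_eq_sum (k := k) F.1 Ω (fun a => g a F.1) fun a ha h =>
      (Finset.mem_filter.1 (SetFamily.mem_supportedOn.1 (hg a ha) _ h)).1
    exact ⟨z, hz⟩
  choose c hc using h
  refine ⟨c, fun a => funext fun F => ?_⟩
  by_cases hF : F.card = j
  · rw [cochainCoeff_apply a c ⟨F, hF⟩, hc]
    split_ifs <;> rfl
  · rw [cochainCoeff_of_card_ne a c hF]
    split_ifs with ha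
    · exact (hg a ha F fun h => hF (Finset.mem_filter.1 h).2).symm
    · rfl

/-- The nonpositive integer vectors with sum `ℓ`. -/
def nonposVectors (V : Type*) [Fintype V] [LinearOrder V] (ℓ : ℤ) : Finset (V → ℤ) :=
  (Finset.Icc (fun _ => ℓ) (0 : V → ℤ)).filter fun a => ∑ v, a v = ℓ

theorem mem_nonposVectors {ℓ : ℤ} {a : V → ℤ} :
    a ∈ nonposVectors V ℓ ↔ (∀ v, a v ≤ 0) ∧ ∑ v, a v = ℓ := by
  rw [nonposVectors, Finset.mem_filter, Finset.mem_Icc]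
  constructor
  · rintro ⟨⟨_, h2⟩, h3⟩
    exact ⟨h2, h3⟩
  · rintro ⟨h1, h2⟩
    refine ⟨⟨fun v => ?_, h1⟩, h2⟩
    rw [← h2, ← Finset.add_sum_erase _ _ (Finset.mem_univ v)]
    have := Finset.sum_nonpos fun w (_ : w ∈ Finset.univ.erase v) => h1 w
    linarith

theorem cochainCoeff_mem_cocycles {j : ℕ} {ℓ : ℤ} {c : CechCochain (edgeIdeal k G) j}
    (hc : c ∈ cechCocycles (edgeIdeal k G) j ℓ) (a : V → ℤ) :
    cochainCoeff j a c ∈ SetFamily.cocycles k (degreeFamily G a) j := by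
  refine ⟨cochainCoeff_mem_supportedOn j a c, ?_⟩
  refine LinearMap.mem_ker.2 ?_
  rw [← cochainCoeff_cechDiff, LinearMap.mem_ker.1 hc.2, map_zero]

/-- The classes of the components in nonpositive multidegrees of a Čech cocycle. -/
def cocycleClasses (k : Type*) [Field k] (G : SimpleGraph V) (j : ℕ) (ℓ : ℤ) :
    cechCocycles (edgeIdeal k G) j ℓ →ₗ[k]
      ((a : nonposVectors V ℓ) → SetFamily.Cohomology k (degreeFamily G a.1) j) :=
  LinearMap.pi fun a => SetFamily.Cohomology.mk _ _ ∘ₗ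
    (((cochainCoeff j a.1).domRestrict (cechCocycles (edgeIdeal k G) j ℓ)).codRestrict
      (SetFamily.cocycles k (degreeFamily G a.1) j) fun c => cochainCoeff_mem_cocycles c.2 a.1)

theorem cocycleClasses_apply_eq_zero_iff {j : ℕ} {ℓ : ℤ} (c : cechCocycles (edgeIdeal k G) j ℓ)
    (a : nonposVectors V ℓ) : cocycleClasses k G j ℓ c a = 0 ↔
      cochainCoeff j a.1 c.1 ∈ SetFamily.coboundaries k (degreeFamily G a.1) j := by
  rw [cocycleClasses, LinearMap.pi_apply, LinearMap.comp_apply,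
    SetFamily.Cohomology.mk_eq_zero_iff]
  rfl

theorem cocycleClasses_surjective (j : ℕ) (ℓ : ℤ) :
    Function.Surjective (cocycleClasses k G j ℓ) := by
  intro q
  have h : ∀ a : nonposVectors V ℓ, ∃ g : SetFamily.cocycles k (degreeFamily G a.1) j,
      SetFamily.Cohomology.mk _ _ g = q a := fun a => SetFamily.Cohomology.mk_surjective _ _ _
  choose g hg using h
  obtain ⟨c, hc⟩ := exists_cochainCoeff_eq (k := k) (G := G) j (nonposVectors V ℓ)
    (fun a => if h : a ∈ nonposVectors V ℓ then (g ⟨a, h⟩).1 else 0) fun a ha => by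
      rw [dif_pos ha]
      exact (g ⟨a, ha⟩).2.1
  have hcz : c ∈ cechCocycles (edgeIdeal k G) j ℓ := by
    refine ⟨mem_cechCochainDegree_iff.2 fun a ha => ?_, ?_⟩
    · rw [hc, if_neg fun h => ha (mem_nonposVectors.1 h).2]
    · refine eq_zero_of_cochainCoeff_eq_zero fun a => ?_
      rw [cochainCoeff_cechDiff, hc]
      split_ifs with ha
      · exact (g ⟨a, ha⟩).2.2
      · exact map_zero _
  refine ⟨⟨c, hcz⟩, funext fun a => ?_⟩
  rw [← hg a, cocycleClasses, LinearMap.pi_apply, LinearMap.comp_apply]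
  congr 1
  refine Subtype.ext ?_
  change cochainCoeff j a.1 c = (g a).1
  rw [hc, if_pos a.2, dif_pos a.2]

/-- A cocycle is a coboundary as soon as each of its components is one: primitives are assembled
over the finitely many nonzero components, and multidegrees with a positive entry are automatically
exact. -/
theorem ker_cocycleClasses (j : ℕ) (ℓ : ℤ) :
    LinearMap.ker (cocycleClasses k G j ℓ) =
      (cechCoboundaries (edgeIdeal k G) j ℓ).submoduleOf (cechCocycles (edgeIdeal k G) j ℓ) := by
  ext c
  rw [LinearMap.mem_ker, Submodule.submoduleOf, Submodule.mem_comap]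
  constructor
  · intro h
    have h1 : ∀ a, cochainCoeff j a c.1 ∈ SetFamily.coboundaries k (degreeFamily G a) j := by
      intro a
      by_cases ha : ∑ v, a v = ℓ
      · by_cases hn : ∀ v, a v ≤ 0
        · exact (cocycleClasses_apply_eq_zero_iff c ⟨a, mem_nonposVectors.2 ⟨hn, ha⟩⟩).1
            (congrFun h _)
        · push Not at hn
          obtain ⟨v, hv⟩ := hn
          rw [← ((degreeFamily_toggleInvariant G hv).exactAt j).cocycles_eq
            (degreeFamily_ordConnected G a)]
          exact cochainCoeff_mem_cocycles c.2 a
      · rw [mem_cechCochainDegree_iff.1 c.2.1 a ha]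
        exact zero_mem _
    cases j with
    | zero =>
      have : c.1 = 0 := by
        refine eq_zero_of_cochainCoeff_eq_zero fun a => ?_
        obtain ⟨e, he, hd⟩ := h1 a
        have : e = 0 := funext fun F => he F (by simp)
        rw [← hd, this, map_zero]
      exact this
    | succ j =>
      choose e he hd using h1
      obtain ⟨b, hb⟩ := exists_cochainCoeff_eq (k := k) (G := G) j
        (finite_cochainCoeff_ne_zero (j + 1) c.1).toFinset e fun a _ => by
          have := he a
          simpa using this
      refine ⟨b, mem_cechCochainDegree_iff.2 fun a ha => ?_, ?_⟩
      · rw [hb, if_neg]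
        rw [Set.Finite.mem_toFinset, Set.mem_ofPred_eq, not_not]
        exact mem_cechCochainDegree_iff.1 c.2.1 a ha
      · rw [← sub_eq_zero]
        refine eq_zero_of_cochainCoeff_eq_zero fun a => ?_
        rw [map_sub, cochainCoeff_cechDiff, hb, sub_eq_zero]
        split_ifs with ha
        · exact hd a
        · rw [map_zero]
          rw [Set.Finite.mem_toFinset, Set.mem_ofPred_eq, not_not] at ha
          exact ha.symm
  · intro h
    funext a
    rw [Pi.zero_apply, cocycleClasses_apply_eq_zero_iff]
    cases j with
    | zero =>
      have : c.1 = 0 := h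
      rw [this, map_zero]
      exact zero_mem _
    | succ j =>
      obtain ⟨b, -, hb⟩ := h
      rw [Submodule.subtype_apply] at hb
      rw [← hb, cochainCoeff_cechDiff]
      refine ⟨_, ?_, rfl⟩
      simpa using cochainCoeff_mem_supportedOn j a.1 b

/-- The multigraded decomposition of the graded pieces of local cohomology. -/
theorem nonempty_localCohomologyDegree_equiv (k : Type*) [Field k] (G : SimpleGraph V) (j : ℕ)
    (ℓ : ℤ) : Nonempty (LocalCohomologyDegree (edgeIdeal k G) j ℓ ≃ₗ[k]
      ((a : nonposVectors V ℓ) → SetFamily.Cohomology k (degreeFamily G a.1) j)) :=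
  nonempty_quotient_equiv_of_ker_eq (cocycleClasses k G j ℓ) (cocycleClasses_surjective j ℓ)
    (ker_cocycleClasses j ℓ)

theorem finite_localCohomologyDegree (k : Type*) [Field k] (G : SimpleGraph V) (j : ℕ) (ℓ : ℤ) :
    Module.Finite k (LocalCohomologyDegree (edgeIdeal k G) j ℓ) :=
  Module.Finite.equiv (nonempty_localCohomologyDegree_equiv k G j ℓ).some.symm

theorem finrank_localCohomologyDegree (k : Type*) [Field k] (G : SimpleGraph V) (j : ℕ) (ℓ : ℤ) :
    Module.finrank k (LocalCohomologyDegree (edgeIdeal k G) j ℓ) =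
      ∑ a ∈ nonposVectors V ℓ,
        Module.finrank k (SetFamily.Cohomology k (degreeFamily G a) j) := by
  rw [(nonempty_localCohomologyDegree_equiv k G j ℓ).some.finrank_eq, Module.finrank_pi_fintype,
    ← Finset.sum_coe_sort (nonposVectors V ℓ) fun a =>
      Module.finrank k (SetFamily.Cohomology k (degreeFamily G a) j)]

end CochainDecomposition

/-! ### Facets of the independence complex of a labelled very well-covered graph -/

section Facets

variable {d₀ : ℕ} {H : SimpleGraph (Fin d₀ ⊕ Fin d₀)}

theorem mem_minVertexCovers {W : Type*} [Fintype W] {H : SimpleGraph W} {C : Finset W} :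
    C ∈ minVertexCovers H ↔ Minimal H.IsVertexCover (C : Set W) := by
  simp [minVertexCovers]

theorem exists_minVertexCovers_subset {W : Type*} [Fintype W] {H : SimpleGraph W} {C : Finset W}
    (hC : H.IsVertexCover (C : Set W)) : ∃ D ∈ minVertexCovers H, D ⊆ C := by
  obtain ⟨D, hD, hmin⟩ := exists_minimal_le_of_wellFoundedLT
    (fun D : Finset W => H.IsVertexCover (D : Set W)) C hC
  refine ⟨D, mem_minVertexCovers.2 ⟨hmin.1, fun E hE hED => ?_⟩, hD⟩
  classical
  have h1 : (E.toFinset : Set W) = E := Set.coe_toFinset E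
  have h2 : E.toFinset ≤ D := by
    intro x hx
    exact hED (by simpa using hx)
  have h3 := hmin.2 (y := E.toFinset) (by beta_reduce; rw [h1]; exact hE) h2
  intro x hx
  simpa using h3 hx

theorem IsVeryWellCovered.card_eq (hH : IsVeryWellCovered H) {C : Finset (Fin d₀ ⊕ Fin d₀)}
    (hC : C ∈ minVertexCovers H) : C.card = d₀ := by
  have := hH.2 C hC
  simp only [Fintype.card_sum, Fintype.card_fin] at this
  omega

/-- A cover contains a minimal one, which already has `d₀` elements. -/
theorem IsVeryWellCovered.mem_minVertexCovers_iff (hH : IsVeryWellCovered H)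
    {C : Finset (Fin d₀ ⊕ Fin d₀)} :
    C ∈ minVertexCovers H ↔ H.IsVertexCover (C : Set (Fin d₀ ⊕ Fin d₀)) ∧ C.card = d₀ := by
  refine ⟨fun h => ⟨(mem_minVertexCovers.1 h).1, hH.card_eq h⟩, fun ⟨h1, h2⟩ => ?_⟩
  obtain ⟨D, hD, hDC⟩ := exists_minVertexCovers_subset h1
  rwa [← Finset.eq_of_subset_of_card_le hDC (by rw [h2, hH.card_eq hD])]

theorem IsStandardLabelling.not_adj_inr (hlab : IsStandardLabelling H) (i j : Fin d₀) :
    ¬ H.Adj (Sum.inr i) (Sum.inr j) := by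
  intro h
  exact hlab.maximal_indep.1 ⟨i, rfl⟩ ⟨j, rfl⟩ h.ne h

/-- A set with `d₀` elements that meets each pair `{x_s, y_s}` meets it in exactly one element. -/
theorem eq_disjSum_compl_of_card {C : Finset (Fin d₀ ⊕ Fin d₀)}
    (hC : ∀ s, Sum.inl s ∈ C ∨ Sum.inr s ∈ C) (hcard : C.card = d₀) :
    ∃ A : Finset (Fin d₀), C = Aᶜ.disjSum A := by
  refine ⟨Finset.univ.filter fun s => Sum.inl s ∉ C, (Finset.eq_of_subset_of_card_le ?_ ?_).symm⟩
  · rintro (s | s) h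
    · rw [Finset.inl_mem_disjSum] at h
      simpa using h
    · rw [Finset.inr_mem_disjSum] at h
      exact (hC s).resolve_left (by simpa using h)
  · rw [hcard, Finset.card_disjSum, add_comm, Finset.card_add_card_compl, Fintype.card_fin]

theorem IsVeryWellCovered.exists_eq_disjSum (hH : IsVeryWellCovered H)
    (hlab : IsStandardLabelling H) {C : Finset (Fin d₀ ⊕ Fin d₀)} (hC : C ∈ minVertexCovers H) :
    ∃ A : Finset (Fin d₀), C = Aᶜ.disjSum A :=
  eq_disjSum_compl_of_card (fun s => (mem_minVertexCovers.1 hC).1 (hlab.matching s))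
    (hH.card_eq hC)

/-- If `x_i y_j` and `x_j z` are edges, then so is `x_i z`. -/
theorem IsVeryWellCovered.adj_trans (hH : IsVeryWellCovered H) (hlab : IsStandardLabelling H)
    {i j : Fin d₀} {z : Fin d₀ ⊕ Fin d₀} (h1 : H.Adj (Sum.inl i) (Sum.inr j))
    (h2 : H.Adj (Sum.inl j) z) : H.Adj (Sum.inl i) z := by
  by_contra h
  -- If `x_i z` is not an edge, the complement of `{x_i, z}` is a cover. A minimal cover inside it
  -- must contain both `y_j` and `x_j`, but it meets each matched pair only once.
  have hcov : H.IsVertexCover (({Sum.inl i, z} : Finset (Fin d₀ ⊕ Fin d₀))ᶜ :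
      Finset (Fin d₀ ⊕ Fin d₀)) := by
    intro u v huv
    by_contra hcon
    simp only [Finset.coe_compl, Set.mem_compl_iff, Finset.mem_coe, Finset.mem_insert,
      Finset.mem_singleton] at hcon
    push Not at hcon
    rcases hcon with ⟨rfl | rfl, rfl | rfl⟩
    · exact huv.ne rfl
    · exact h huv
    · exact h huv.symm
    · exact huv.ne rfl
  obtain ⟨D, hD, hDC⟩ := exists_minVertexCovers_subset hcov
  obtain ⟨A, rfl⟩ := hH.exists_eq_disjSum hlab hD
  have hDcov := (mem_minVertexCovers.1 hD).1
  have hi : Sum.inl i ∉ Aᶜ.disjSum A := fun h' => by simpa using hDC h'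
  have hz : z ∉ Aᶜ.disjSum A := fun h' => by simpa using hDC h'
  have hj1 : Sum.inr j ∈ Aᶜ.disjSum A := (hDcov h1).resolve_left hi
  have hj2 : Sum.inl j ∈ Aᶜ.disjSum A := (hDcov h2).resolve_right hz
  rw [Finset.inr_mem_disjSum] at hj1
  rw [Finset.inl_mem_disjSum, Finset.mem_compl] at hj2
  exact hj2 hj1

/-- The set `{x_s : s ∈ A} ∪ {y_s : s ∉ A}` is independent. -/
def IsFacetIndex (H : SimpleGraph (Fin d₀ ⊕ Fin d₀)) (A : Finset (Fin d₀)) : Prop :=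
  ∀ u v, H.Adj u v → u ∈ A.disjSum Aᶜ → v ∉ A.disjSum Aᶜ

open Classical in
/-- The indices `s ∈ A` such that `x_s` is the only neighbour of `y_s` among the `x_i`, `i ∈ A`. -/
def restrictionIndices (H : SimpleGraph (Fin d₀ ⊕ Fin d₀)) (A : Finset (Fin d₀)) :
    Finset (Fin d₀) :=
  A.filter fun s => ∀ i ∈ A, H.Adj (Sum.inl i) (Sum.inr s) → i = s

theorem mem_restrictionIndices {A : Finset (Fin d₀)} {s : Fin d₀} :
    s ∈ restrictionIndices H A ↔ s ∈ A ∧ ∀ i ∈ A, H.Adj (Sum.inl i) (Sum.inr s) → i = s := by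
  simp [restrictionIndices]

theorem compl_disjSum_mem_minVertexCovers_iff (hH : IsVeryWellCovered H) {A : Finset (Fin d₀)} :
    Aᶜ.disjSum A ∈ minVertexCovers H ↔ IsFacetIndex H A := by
  have hcard : (Aᶜ.disjSum A).card = d₀ := by
    rw [Finset.card_disjSum, add_comm, Finset.card_add_card_compl, Fintype.card_fin]
  have hmem : ∀ u, u ∈ Aᶜ.disjSum A ↔ u ∉ A.disjSum Aᶜ := by
    rintro (s | s) <;> simp
  rw [hH.mem_minVertexCovers_iff, and_iff_left hcard]
  constructor
  · intro h u v huv hu hv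
    rcases h huv with h | h
    · exact (hmem u).1 h hu
    · exact (hmem v).1 h hv
  · intro h u v huv
    by_cases hu : u ∈ A.disjSum Aᶜ
    · exact Or.inr ((hmem v).2 (h u v huv hu))
    · exact Or.inl ((hmem u).2 hu)

/-- Exchanging `x_s` for `y_s` in a facet creates new edges only between `y_s` and the remaining
`x_i`, because the `y`'s are independent. -/
theorem isFacetIndex_erase_iff (hlab : IsStandardLabelling H) {A : Finset (Fin d₀)}
    (hA : IsFacetIndex H A) {s : Fin d₀} (hs : s ∈ A) :
    IsFacetIndex H (A.erase s) ↔ s ∈ restrictionIndices H A := by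
  rw [mem_restrictionIndices]
  constructor
  · intro h
    refine ⟨hs, fun i hi hadj => ?_⟩
    by_contra his
    exact h _ _ hadj (by simp [his, hi]) (by simp)
  · rintro ⟨-, h⟩ u v huv hu hv
    have key : ∀ i (w : Fin d₀ ⊕ Fin d₀), H.Adj (Sum.inl i) w →
        Sum.inl i ∈ (A.erase s).disjSum (A.erase s)ᶜ → w ∈ (A.erase s).disjSum (A.erase s)ᶜ →
        False := by
      intro i w hiw hi hw
      simp only [Finset.inl_mem_disjSum, Finset.mem_erase] at hi
      rcases w with t | t
      · simp only [Finset.inl_mem_disjSum, Finset.mem_erase] at hw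
        exact hA _ _ hiw (by simp [hi.2]) (by simp [hw.2])
      · simp only [Finset.inr_mem_disjSum, Finset.mem_compl, Finset.mem_erase, not_and] at hw
        by_cases hts : t = s
        · subst hts
          exact hi.1 (h i hi.2 hiw)
        · exact hA _ _ hiw (by simp [hi.2]) (by simp [hw hts])
    rcases u with i | i
    · exact key i v huv hu hv
    · rcases v with t | t
      · exact key t _ huv.symm hv hu
      · exact hlab.not_adj_inr _ _ huv

theorem exchangeSet_eq (hH : IsVeryWellCovered H) (hlab : IsStandardLabelling H)
    {A : Finset (Fin d₀)} (hA : IsFacetIndex H A) :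
    exchangeSet H (Aᶜ.disjSum A) = (restrictionIndices H A).map Function.Embedding.inl := by
  classical
  ext v
  simp only [exchangeSet, Finset.mem_filter, Finset.mem_univ, true_and, Finset.mem_map,
    Function.Embedding.inl_apply]
  have key : ∀ s ∈ A, insert (Sum.inl s) ((Aᶜ.disjSum A).erase (Sum.inr s)) =
      (A.erase s)ᶜ.disjSum (A.erase s) := by
    intro s _
    ext (t | t)
    · simp only [Finset.mem_insert, Sum.inl.injEq, Finset.mem_erase, ne_eq, reduceCtorEq,
        not_false_eq_true, true_and, Finset.inl_mem_disjSum, Finset.mem_compl]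
      tauto
    · simp
  constructor
  · rintro ⟨s, rfl, hs, h⟩
    rw [Finset.inr_mem_disjSum] at hs
    refine ⟨s, ?_, rfl⟩
    convert_to insert (Sum.inl s) ((Aᶜ.disjSum A).erase (Sum.inr s)) ∈ minVertexCovers H at h
    rw [key s hs, compl_disjSum_mem_minVertexCovers_iff hH] at h
    exact (isFacetIndex_erase_iff hlab hA hs).1 h
  · rintro ⟨s, hs, rfl⟩
    have hsA := (mem_restrictionIndices.1 hs).1
    refine ⟨s, rfl, by simpa using hsA, ?_⟩
    convert_to insert (Sum.inl s) ((Aᶜ.disjSum A).erase (Sum.inr s)) ∈ minVertexCovers H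
    rw [key s hsA, compl_disjSum_mem_minVertexCovers_iff hH]
    exact (isFacetIndex_erase_iff hlab hA hsA).2 hs

end Facets

/-! ### Interval partition of the independence complex, lifted along the blow-up -/

section BlowUp

variable {d₀ : ℕ} {H : SimpleGraph (Fin d₀ ⊕ Fin d₀)} {V : Type*} [Fintype V] [LinearOrder V]
  {G : SimpleGraph V} {π : V → Fin d₀ ⊕ Fin d₀}

open Classical in
/-- The indices `s` such that `y_s` is adjacent to an element of the image of `σ`. -/
def dominatedIndices (H : SimpleGraph (Fin d₀ ⊕ Fin d₀)) (π : V → Fin d₀ ⊕ Fin d₀)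
    (σ : Finset V) : Finset (Fin d₀) :=
  Finset.univ.filter fun s => ∃ v ∈ σ, H.Adj (Sum.inr s) (π v)

theorem mem_dominatedIndices {σ : Finset V} {s : Fin d₀} :
    s ∈ dominatedIndices H π σ ↔ ∃ v ∈ σ, H.Adj (Sum.inr s) (π v) := by
  simp [dominatedIndices]

theorem dominatedIndices_mono {σ τ : Finset V} (h : σ ⊆ τ) :
    dominatedIndices H π σ ⊆ dominatedIndices H π τ := by
  intro s hs
  rw [mem_dominatedIndices] at *
  obtain ⟨v, hv, h'⟩ := hs
  exact ⟨v, h hv, h'⟩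

theorem exists_inl_of_mem_dominatedIndices (hlab : IsStandardLabelling H) {σ : Finset V}
    {s : Fin d₀} (h : s ∈ dominatedIndices H π σ) :
    ∃ v ∈ σ, ∃ i, π v = Sum.inl i ∧ H.Adj (Sum.inl i) (Sum.inr s) := by
  obtain ⟨v, hv, hadj⟩ := mem_dominatedIndices.1 h
  rcases hπ : π v with i | i
  · rw [hπ] at hadj
    exact ⟨v, hv, i, hπ, hadj.symm⟩
  · rw [hπ] at hadj
    exact absurd hadj (hlab.not_adj_inr _ _)

/-- If `i` is dominated through some `x_l` in the image of `σ`, transitivity moves any edge at `x_i`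
to `x_l`. An edge inside the proposed facet would therefore give either an edge inside `σ` or a
`y_t` that is dominated after all. -/
theorem isFacetIndex_dominatedIndices (hH : IsVeryWellCovered H) (hlab : IsStandardLabelling H)
    (hG : ∀ u v, G.Adj u v ↔ H.Adj (π u) (π v)) {σ : Finset V}
    (hσ : ∀ u v, G.Adj u v → u ∈ σ → v ∉ σ) : IsFacetIndex H (dominatedIndices H π σ) := by
  have key : ∀ i w, H.Adj (Sum.inl i) w →
      Sum.inl i ∈ (dominatedIndices H π σ).disjSum (dominatedIndices H π σ)ᶜ →
      w ∈ (dominatedIndices H π σ).disjSum (dominatedIndices H π σ)ᶜ → False := by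
    intro i w hiw hi hw
    rw [Finset.inl_mem_disjSum] at hi
    obtain ⟨u, hu, l, hul, hadj⟩ := exists_inl_of_mem_dominatedIndices hlab hi
    have h1 := hH.adj_trans hlab hadj hiw
    rcases w with t | t
    · rw [Finset.inl_mem_disjSum] at hw
      obtain ⟨u', hu', l', hul', hadj'⟩ := exists_inl_of_mem_dominatedIndices hlab hw
      have h2 := hH.adj_trans hlab hadj' h1.symm
      rw [← hul, ← hul', ← hG] at h2
      exact hσ _ _ h2 hu' hu
    · rw [Finset.inr_mem_disjSum, Finset.mem_compl, mem_dominatedIndices] at hw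
      exact hw ⟨u, hu, hul ▸ h1.symm⟩
  rintro (i | i) v huv hu hv
  · exact key i v huv hu hv
  · rcases v with t | t
    · exact key t _ huv.symm hv hu
    · exact hlab.not_adj_inr _ _ huv

theorem map_mem_disjSum_dominatedIndices (hlab : IsStandardLabelling H)
    (hG : ∀ u v, G.Adj u v ↔ H.Adj (π u) (π v)) {σ : Finset V}
    (hσ : ∀ u v, G.Adj u v → u ∈ σ → v ∉ σ) {v : V} (hv : v ∈ σ) :
    π v ∈ (dominatedIndices H π σ).disjSum (dominatedIndices H π σ)ᶜ := by
  rcases hπ : π v with s | s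
  · rw [Finset.inl_mem_disjSum, mem_dominatedIndices]
    exact ⟨v, hv, hπ ▸ (hlab.matching s).symm⟩
  · rw [Finset.inr_mem_disjSum, Finset.mem_compl, mem_dominatedIndices]
    rintro ⟨w, hw, hadj⟩
    rw [← hπ, ← hG] at hadj
    exact hσ _ _ hadj hv hw

/-- This is the interval partition: among the faces of the facet of `A`, those assigned to `A` are
the ones meeting the fibre over every restriction vertex `x_s`. -/
theorem dominatedIndices_eq_iff (hH : IsVeryWellCovered H) (hlab : IsStandardLabelling H)
    {A : Finset (Fin d₀)} (hA : IsFacetIndex H A) {σ : Finset V}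
    (hσ : ∀ v ∈ σ, π v ∈ A.disjSum Aᶜ) :
    dominatedIndices H π σ = A ↔ ∀ s ∈ restrictionIndices H A, ∃ v ∈ σ, π v = Sum.inl s := by
  constructor
  · rintro h s hs
    rw [mem_restrictionIndices] at hs
    have hs1 := hs.1
    rw [← h] at hs1
    obtain ⟨v, hv, i, hvi, hadj⟩ := exists_inl_of_mem_dominatedIndices hlab hs1
    have hi := hσ v hv
    rw [hvi, Finset.inl_mem_disjSum] at hi
    rw [hs.2 i hi hadj] at hvi
    exact ⟨v, hv, hvi⟩
  · intro h
    apply Finset.Subset.antisymm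
    · intro s hs
      obtain ⟨v, hv, hadj⟩ := mem_dominatedIndices.1 hs
      by_contra hsA
      exact hA _ _ hadj (by simpa using hsA) (hσ v hv)
    · intro t
      -- An index `t ∈ A` outside the restriction has `x_i y_t` an edge for some other `i ∈ A`, and
      -- the labelling forces `i < t`. By induction `i` is dominated, and transitivity carries this
      -- to `t`.
      induction t using WellFoundedLT.induction with
      | ind t ih =>
        intro ht
        by_cases htR : t ∈ restrictionIndices H A
        · obtain ⟨v, hv, hvt⟩ := h t htR
          exact mem_dominatedIndices.2 ⟨v, hv, hvt ▸ (hlab.matching t).symm⟩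
        · rw [mem_restrictionIndices, not_and] at htR
          have := htR ht
          push Not at this
          obtain ⟨i, hi, hadj, hne⟩ := this
          obtain ⟨v, hv, l, hvl, hadj'⟩ := exists_inl_of_mem_dominatedIndices hlab
            (ih i (lt_of_le_of_ne (hlab.le_of_adj i t hadj) hne) hi)
          exact mem_dominatedIndices.2 ⟨v, hv, hvl ▸ (hH.adj_trans hlab hadj' hadj).symm⟩

open Classical in
/-- The independent sets of `G` that contain `N`. -/
def starFamily (G : SimpleGraph V) (N : Finset V) : Finset (Finset V) :=
  Finset.univ.filter fun F => N ⊆ F ∧ ∀ u v, G.Adj u v → u ∈ F → v ∉ F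

theorem mem_starFamily {N F : Finset V} :
    F ∈ starFamily G N ↔ N ⊆ F ∧ ∀ u v, G.Adj u v → u ∈ F → v ∉ F := by
  simp [starFamily]

theorem degreeFamily_of_nonpos {a : V → ℤ} (ha : ∀ v, a v ≤ 0) :
    degreeFamily G a = starFamily G (Finset.univ.filter fun v => a v ≠ 0) := by
  ext F
  rw [mem_degreeFamily, mem_starFamily]
  have h1 : (∀ v, a v < 0 → v ∈ F) ↔ (Finset.univ.filter fun v => a v ≠ 0) ⊆ F := by
    constructor
    · intro h v hv
      exact h v (lt_of_le_of_ne (ha v) (Finset.mem_filter.1 hv).2)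
    · intro h v hv
      exact h (Finset.mem_filter.2 ⟨Finset.mem_univ v, hv.ne⟩)
  rw [h1]
  refine and_congr_right fun h => ?_
  have h2 : ∀ v, (a v ≠ 0 ∨ v ∈ F) ↔ v ∈ F := fun v =>
    or_iff_right_of_imp fun hv => h (Finset.mem_filter.2 ⟨Finset.mem_univ v, hv⟩)
  simp only [h2]

theorem starFamily_ordConnected (N : Finset V) :
    (starFamily G N : Set (Finset V)).OrdConnected := by
  refine ⟨fun E hE F hF D hD => ?_⟩
  rw [Finset.mem_coe, mem_starFamily] at *
  exact ⟨hE.1.trans hD.1, fun u v huv hu hv => hF.2 u v huv (hD.2 hu) (hD.2 hv)⟩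

theorem mem_starFamily_and_dominatedIndices_iff (hH : IsVeryWellCovered H)
    (hlab : IsStandardLabelling H) (hG : ∀ u v, G.Adj u v ↔ H.Adj (π u) (π v)) {N F : Finset V}
    {A : Finset (Fin d₀)} :
    (F ∈ starFamily G N ∧ dominatedIndices H π F = A) ↔ N ⊆ F ∧ IsFacetIndex H A ∧
      (∀ v ∈ F, π v ∈ A.disjSum Aᶜ) ∧
        ∀ s ∈ restrictionIndices H A, ∃ v ∈ F, π v = Sum.inl s := by
  rw [mem_starFamily]
  constructor
  · rintro ⟨⟨h1, h2⟩, rfl⟩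
    have h3 := isFacetIndex_dominatedIndices hH hlab hG h2
    have h4 := fun v (hv : v ∈ F) => map_mem_disjSum_dominatedIndices hlab hG h2 hv
    exact ⟨h1, h3, h4, (dominatedIndices_eq_iff hH hlab h3 h4).1 rfl⟩
  · rintro ⟨h1, h3, h4, h5⟩
    refine ⟨⟨h1, fun u v huv hu hv => ?_⟩, (dominatedIndices_eq_iff hH hlab h3 h4).2 h5⟩
    exact h3 _ _ ((hG u v).1 huv) (h4 u hu) (h4 v hv)

open Classical in
/-- The pairs `(A, D)` of a facet index and a subset `D` of its restriction such that `N` is the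
preimage of the facet with `{x_s : s ∈ D}` removed. -/
def criticalPairs (H : SimpleGraph (Fin d₀ ⊕ Fin d₀)) (π : V → Fin d₀ ⊕ Fin d₀) (N : Finset V) :
    Finset (Finset (Fin d₀) × Finset (Fin d₀)) :=
  Finset.univ.filter fun p => IsFacetIndex H p.1 ∧ p.2 ⊆ restrictionIndices H p.1 ∧
    N = Finset.univ.filter fun v => π v ∈ (p.1 \ p.2).disjSum p.1ᶜ

theorem mem_criticalPairs {N : Finset V} {A D : Finset (Fin d₀)} :
    (A, D) ∈ criticalPairs H π N ↔ IsFacetIndex H A ∧ D ⊆ restrictionIndices H A ∧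
      N = Finset.univ.filter fun v => π v ∈ (A \ D).disjSum Aᶜ := by
  simp [criticalPairs]

/-- Taking the base point outside `N` whenever possible makes its membership in `N` a test for the
whole fibre lying in `N`. -/
theorem exists_basePoints (hπ : Function.Surjective π) (N : Finset V) :
    ∃ b : Fin d₀ ⊕ Fin d₀ → V, (∀ u, π (b u) = u) ∧ ∀ u, b u ∈ N → ∀ v, π v = u → v ∈ N := by
  have : ∀ u, ∃ w, π w = u ∧ (w ∈ N → ∀ v, π v = u → v ∈ N) := by
    intro u
    by_cases h : ∃ w, π w = u ∧ w ∉ N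
    · obtain ⟨w, hw, hwN⟩ := h
      exact ⟨w, hw, fun h => absurd h hwN⟩
    · push Not at h
      obtain ⟨w, hw⟩ := hπ u
      exact ⟨w, hw, fun _ => h⟩
  choose b hb hb' using this
  exact ⟨b, hb, hb'⟩

end BlowUp

/-! ### Discrete Morse theory on the faces containing `N` -/

section BlowUpCohomology

variable {d₀ : ℕ} {H : SimpleGraph (Fin d₀ ⊕ Fin d₀)} {V : Type*} [Fintype V] [LinearOrder V]
  {G : SimpleGraph V} {π : V → Fin d₀ ⊕ Fin d₀}

/-- The Morse function on the star of `N`: the facet containing `F`, and the elements of `F` that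
are not base points. -/
def morseMap (H : SimpleGraph (Fin d₀ ⊕ Fin d₀)) (π : V → Fin d₀ ⊕ Fin d₀)
    (b : Fin d₀ ⊕ Fin d₀ → V) (F : Finset V) : Finset (Fin d₀) × Finset V :=
  (dominatedIndices H π F, F.filter fun v => v ≠ b (π v))

/-- The values of the Morse function whose fibres are critical. -/
def IsCriticalValue (H : SimpleGraph (Fin d₀ ⊕ Fin d₀)) (π : V → Fin d₀ ⊕ Fin d₀)
    (b : Fin d₀ ⊕ Fin d₀ → V) (N : Finset V) (p : Finset (Fin d₀) × Finset V) : Prop :=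
  ∀ u ∈ p.1.disjSum p.1ᶜ, b u ∈ N ∨
    ∃ s ∈ restrictionIndices H p.1, u = Sum.inl s ∧ ∀ v ∈ p.2, π v ≠ u

/-- A noncritical value supplies a facet vertex `u` with `b u ∉ N` such that, if `u` is a
restriction vertex, its fibre is already met by a point other than `b u`. Toggling `b u` then
affects neither the facet, nor the points that are not base points, nor the inclusion of `N`. -/
theorem toggleInvariant_morseMap_fiber (hH : IsVeryWellCovered H)
    (hlab : IsStandardLabelling H) (hG : ∀ u v, G.Adj u v ↔ H.Adj (π u) (π v)) {N : Finset V}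
    {b : Fin d₀ ⊕ Fin d₀ → V} (hb : ∀ u, π (b u) = u) {p : Finset (Fin d₀) × Finset V}
    (hp : ¬ IsCriticalValue H π b N p) :
    ∃ v, SetFamily.ToggleInvariant ((starFamily G N).filter (morseMap H π b · = p)) v := by
  obtain ⟨A, T⟩ := p
  rw [IsCriticalValue] at hp
  push Not at hp
  obtain ⟨u, hu, huN, hex⟩ := hp
  simp only at hu hex
  refine ⟨b u, fun F => ?_⟩
  have hmem : ∀ F, F ∈ (starFamily G N).filter (morseMap H π b · = (A, T)) ↔
      (N ⊆ F ∧ IsFacetIndex H A ∧ (∀ v ∈ F, π v ∈ A.disjSum Aᶜ) ∧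
        ∀ s ∈ restrictionIndices H A, ∃ v ∈ F, π v = Sum.inl s) ∧
      (F.filter fun v => v ≠ b (π v)) = T := by
    intro F
    rw [← mem_starFamily_and_dominatedIndices_iff hH hlab hG, Finset.mem_filter, morseMap,
      Prod.mk.injEq, and_assoc]
  rw [hmem, hmem]
  have hT : (insert (b u) F).filter (fun v => v ≠ b (π v)) =
      (F.erase (b u)).filter fun v => v ≠ b (π v) := by
    ext v
    simp only [Finset.mem_filter, Finset.mem_insert, Finset.mem_erase]
    have : v ≠ b (π v) → v ≠ b u := by
      rintro h rfl
      rw [hb] at h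
      exact h rfl
    tauto
  rw [hT]
  refine and_congr_left fun hFT => and_congr ?_ (and_congr_right fun _ => and_congr ?_ ?_)
  · constructor
    · intro h v hv
      have hne : v ≠ b u := fun e => huN (e ▸ hv)
      exact Finset.mem_erase.2 ⟨hne, (Finset.mem_insert.1 (h hv)).resolve_left hne⟩
    · exact fun h => h.trans ((Finset.erase_subset _ _).trans (Finset.subset_insert _ _))
  · constructor
    · exact fun h v hv => h v (Finset.mem_insert_of_mem (Finset.mem_of_mem_erase hv))
    · intro h v hv
      by_cases hv' : v = b u
      · rw [hv', hb]; exact hu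
      · exact h v (Finset.mem_erase.2 ⟨hv', (Finset.mem_insert.1 hv).resolve_left hv'⟩)
  · constructor
    · intro h s hs
      by_cases hsu : u = Sum.inl s
      · obtain ⟨v, hv, hvu⟩ := hex s hs hsu
        rw [← hFT, Finset.mem_filter] at hv
        exact ⟨v, hv.1, hvu.trans hsu⟩
      · obtain ⟨v, hv, hvs⟩ := h s hs
        have hne : v ≠ b u := by
          rintro rfl
          rw [hb] at hvs
          exact hsu hvs
        exact ⟨v, Finset.mem_erase.2 ⟨hne, (Finset.mem_insert.1 hv).resolve_left hne⟩, hvs⟩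
    · intro h s hs
      obtain ⟨v, hv, hvs⟩ := h s hs
      exact ⟨v, Finset.mem_insert_of_mem (Finset.mem_of_mem_erase hv), hvs⟩

section CriticalCells

variable (hH : IsVeryWellCovered H) (hlab : IsStandardLabelling H)
  (hG : ∀ u v, G.Adj u v ↔ H.Adj (π u) (π v)) {N F : Finset V} {b : Fin d₀ ⊕ Fin d₀ → V}
  (hb : ∀ u, π (b u) = u) (hbN : ∀ u, b u ∈ N → ∀ v, π v = u → v ∈ N)
  (hF : F ∈ starFamily G N) (hcrit : IsCriticalValue H π b N (morseMap H π b F))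

include hlab hG hbN hF hcrit in
theorem eq_basePoint_of_critical {v : V} (hv : v ∈ F) (hvN : v ∉ N) : v = b (π v) := by
  have hF' := mem_starFamily.1 hF
  have h := hcrit (π v) (map_mem_disjSum_dominatedIndices hlab hG hF'.2 hv)
  rcases h with h | ⟨s, -, -, h⟩
  · exact absurd (hbN _ h v rfl) hvN
  · by_contra hne
    exact h v (Finset.mem_filter.2 ⟨hv, hne⟩) rfl

include hlab hG hF hcrit in
theorem basePoint_mem_of_critical {v : V} (hv : v ∈ N) : b (π v) ∈ N := by
  have hF' := mem_starFamily.1 hF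
  have h := hcrit (π v) (map_mem_disjSum_dominatedIndices hlab hG hF'.2 (hF'.1 hv))
  rcases h with h | ⟨s, -, -, h⟩
  · exact h
  · by_cases hne : v = b (π v)
    · rwa [← hne]
    · exact absurd rfl (h v (Finset.mem_filter.2 ⟨hF'.1 hv, hne⟩))

include hH hlab hG hF hcrit in
theorem basePoint_mem_face_of_critical {u : Fin d₀ ⊕ Fin d₀}
    (hu : u ∈ (dominatedIndices H π F).disjSum (dominatedIndices H π F)ᶜ) (huN : b u ∉ N) :
    b u ∈ F := by
  rcases hcrit u hu with h | ⟨s, hs, rfl, h⟩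
  · exact absurd h huN
  · obtain ⟨v, hv, hvs⟩ :=
      ((mem_starFamily_and_dominatedIndices_iff hH hlab hG).1 ⟨hF, rfl⟩).2.2.2 s hs
    have : v = b (π v) := by
      by_contra hne
      exact h v (Finset.mem_filter.2 ⟨hv, hne⟩) hvs
    rw [hvs] at this
    rwa [← this]

open Classical in
include hH hlab hG hb hbN hF hcrit in
theorem union_basePoints_eq_of_critical :
    N ∪ (Finset.univ.filter fun s => s ∈ dominatedIndices H π F ∧ b (Sum.inl s) ∉ N).image
      (fun s => b (Sum.inl s)) = F := by
  have hF' := mem_starFamily.1 hF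
  ext v
  simp only [Finset.mem_union, Finset.mem_image, Finset.mem_filter, Finset.mem_univ, true_and]
  constructor
  · rintro (h | ⟨s, ⟨hs, hsN⟩, rfl⟩)
    · exact hF'.1 h
    · exact basePoint_mem_face_of_critical hH hlab hG hF hcrit (by simpa using hs) hsN
  · intro hv
    by_cases hvN : v ∈ N
    · exact Or.inl hvN
    · have h1 := eq_basePoint_of_critical hlab hG hbN hF hcrit hv hvN
      have h2 := map_mem_disjSum_dominatedIndices hlab hG hF'.2 hv
      rcases hcrit (π v) h2 with h | ⟨s, hs, hvs, -⟩
      · exact absurd (h1 ▸ h) hvN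
      · rw [hvs] at h1
        exact Or.inr ⟨s, ⟨(mem_restrictionIndices.1 hs).1, h1 ▸ hvN⟩, h1.symm⟩

open Classical in
include hH hlab hG hb hbN hF hcrit in
-- Criticality leaves only two kinds of fibres over the facet: those contained in `N`, and those
-- over restriction vertices that avoid `N` entirely. The latter are indexed by the second
-- component.
theorem mem_criticalPairs_of_critical :
    (dominatedIndices H π F,
      Finset.univ.filter fun s => s ∈ dominatedIndices H π F ∧ b (Sum.inl s) ∉ N) ∈
        criticalPairs H π N := by
  have hF' := mem_starFamily.1 hF
  rw [mem_criticalPairs]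
  refine ⟨isFacetIndex_dominatedIndices hH hlab hG hF'.2, ?_, ?_⟩
  · intro s hs
    simp only [Finset.mem_filter, Finset.mem_univ, true_and] at hs
    rcases hcrit (Sum.inl s) (by simpa [morseMap] using hs.1) with h | ⟨t, ht, hst, -⟩
    · exact absurd h hs.2
    · rw [Sum.inl.injEq] at hst
      rwa [hst]
  · ext v
    simp only [Finset.mem_filter, Finset.mem_univ, true_and]
    constructor
    · intro hv
      have h1 := map_mem_disjSum_dominatedIndices hlab hG hF'.2 (hF'.1 hv)
      have h2 := basePoint_mem_of_critical hlab hG hF hcrit hv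
      rcases hπ : π v with s | s
      · rw [hπ] at h1 h2
        rw [Finset.inl_mem_disjSum] at h1
        simp [h1, h2]
      · rw [hπ] at h1
        simpa using h1
    · intro hv
      have h1 : π v ∈ (dominatedIndices H π F).disjSum (dominatedIndices H π F)ᶜ := by
        rcases hπ : π v with s | s
        · rw [hπ, Finset.inl_mem_disjSum, Finset.mem_sdiff] at hv
          simpa using hv.1
        · rw [hπ] at hv
          simpa using hv
      have h2 : b (π v) ∈ N := by
        rcases hcrit (π v) h1 with h | ⟨s, hs, hvs, -⟩
        · exact h
        · rw [hvs, Finset.inl_mem_disjSum, Finset.mem_sdiff] at hv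
          rw [hvs]
          by_contra h
          exact hv.2 (by simp [hv.1, h])
      exact hbN _ h2 v rfl

end CriticalCells

/-- `N` alone determines `|D|`, since a facet has `d₀` vertices and `π(N)` is the facet without `D`.
This puts all critical faces in one cardinality. -/
theorem card_criticalPairs_fst_add {N : Finset V} {A D : Finset (Fin d₀)}
    (hπ : Function.Surjective π) (h : (A, D) ∈ criticalPairs H π N) :
    (N.image π).card + D.card = d₀ := by
  obtain ⟨-, h2, h3⟩ := mem_criticalPairs.1 h
  have hDA : D ⊆ A := fun s hs => (mem_restrictionIndices.1 (h2 hs)).1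
  have h4 : N.image π = (A \ D).disjSum Aᶜ := by
    rw [h3]
    ext u
    simp only [Finset.mem_image, Finset.mem_filter, Finset.mem_univ, true_and]
    constructor
    · rintro ⟨v, hv, rfl⟩; exact hv
    · intro hu
      obtain ⟨v, rfl⟩ := hπ u
      exact ⟨v, hu, rfl⟩
  have h5 := Finset.card_sdiff_add_card_eq_card hDA
  have h6 := Finset.card_add_card_compl A
  rw [Fintype.card_fin] at h6
  rw [h4, Finset.card_disjSum]
  omega

open Classical in
-- The inverse of passing from a critical face to its pair: adding to `N` the base points over `D`
-- meets every restriction fibre, and over `D` no other points are present.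
theorem union_image_mem_of_mem_criticalPairs (hH : IsVeryWellCovered H)
    (hlab : IsStandardLabelling H) (hG : ∀ u v, G.Adj u v ↔ H.Adj (π u) (π v)) {N : Finset V}
    {b : Fin d₀ ⊕ Fin d₀ → V} (hb : ∀ u, π (b u) = u)
    {A D : Finset (Fin d₀)} (h : (A, D) ∈ criticalPairs H π N) :
    (N ∪ D.image (fun s => b (Sum.inl s)) ∈ starFamily G N ∧
      dominatedIndices H π (N ∪ D.image fun s => b (Sum.inl s)) = A) ∧
    IsCriticalValue H π b N (morseMap H π b (N ∪ D.image fun s => b (Sum.inl s))) ∧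
    (Finset.univ.filter fun s => s ∈ A ∧ b (Sum.inl s) ∉ N) = D := by
  obtain ⟨h1, h2, h3⟩ := mem_criticalPairs.1 h
  have hDA : D ⊆ A := fun s hs => (mem_restrictionIndices.1 (h2 hs)).1
  have hN : ∀ v, v ∈ N ↔ π v ∈ (A \ D).disjSum Aᶜ := fun v => by rw [h3]; simp
  have hbN : ∀ s ∈ A, b (Sum.inl s) ∈ N ↔ s ∉ D := fun s hs => by rw [hN, hb]; simp [hs]
  have hmem := (mem_starFamily_and_dominatedIndices_iff (N := N)
    (F := N ∪ D.image fun s => b (Sum.inl s)) (A := A) hH hlab hG).2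
    ⟨Finset.subset_union_left, h1, by
      intro v hv
      rcases Finset.mem_union.1 hv with hv | hv
      · rw [hN] at hv
        rcases hπ : π v with s | s
        · rw [hπ, Finset.inl_mem_disjSum, Finset.mem_sdiff] at hv
          simpa using hv.1
        · rw [hπ] at hv
          simpa using hv
      · obtain ⟨s, hs, rfl⟩ := Finset.mem_image.1 hv
        rw [hb]
        simpa using hDA hs, by
      intro s hs
      refine ⟨b (Sum.inl s), ?_, hb _⟩
      rw [Finset.mem_union]
      by_cases hsD : s ∈ D
      · exact Or.inr (Finset.mem_image_of_mem _ hsD)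
      · exact Or.inl ((hbN s (mem_restrictionIndices.1 hs).1).2 hsD)⟩
  refine ⟨hmem, ?_, ?_⟩
  · rw [morseMap, hmem.2]
    rintro (s | s) hu
    · simp only [Finset.inl_mem_disjSum] at hu
      by_cases hsD : s ∈ D
      · refine Or.inr ⟨s, h2 hsD, rfl, fun v hv hvs => ?_⟩
        obtain ⟨hv, hne⟩ := Finset.mem_filter.1 hv
        rcases Finset.mem_union.1 hv with hv | hv
        · rw [hN, hvs] at hv
          simp [hsD] at hv
        · obtain ⟨t, -, rfl⟩ := Finset.mem_image.1 hv
          exact hne (by rw [hb])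
      · exact Or.inl ((hbN s hu).2 hsD)
    · left
      rw [hN, hb]
      simpa using hu
  · ext s
    simp only [Finset.mem_filter, Finset.mem_univ, true_and]
    constructor
    · rintro ⟨hs, hsN⟩
      rwa [hbN s hs, not_not] at hsN
    · intro hs
      exact ⟨hDA hs, by rwa [hbN s (hDA hs), not_not]⟩

open Classical in
/-- The cohomology of the star of `N` in the independence complex of the blown-up graph. -/
theorem finrank_cohomology_starFamily {k : Type*} [Field k] (hH : IsVeryWellCovered H)
    (hlab : IsStandardLabelling H) (hG : ∀ u v, G.Adj u v ↔ H.Adj (π u) (π v))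
    (hπ : Function.Surjective π) (N : Finset V) (j : ℕ) :
    Module.finrank k (SetFamily.Cohomology k (starFamily G N) j) =
      ((criticalPairs H π N).filter fun p => j = N.card + p.2.card).card := by
  obtain ⟨b, hb, hbN⟩ := exists_basePoints hπ N
  have hbinj : Function.Injective fun s => b (Sum.inl s) := by
    intro s t hst
    have := congrArg π hst
    simpa [hb] using this
  rw [SetFamily.finrank_cohomology_of_monotone (morseMap H π b)
    (N.card + (d₀ - (N.image π).card)) (IsCriticalValue H π b N) (starFamily G N)
    (starFamily_ordConnected N)]
  -- As `|D|` is constant on critical pairs, the filter keeps all of them or none.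
  · have h1 : (criticalPairs H π N).filter (fun p => j = N.card + p.2.card) =
        if j = N.card + (d₀ - (N.image π).card) then criticalPairs H π N else ∅ := by
      split_ifs with hj
      · refine Finset.filter_true_of_mem fun p hp => ?_
        have := card_criticalPairs_fst_add hπ hp
        omega
      · refine Finset.filter_false_of_mem fun p hp => ?_
        have := card_criticalPairs_fst_add hπ hp
        omega
    rw [h1]
    split_ifs with hj
    swap; · rfl
    refine Finset.card_bij' (fun F _ => (dominatedIndices H π F,
        Finset.univ.filter fun s => s ∈ dominatedIndices H π F ∧ b (Sum.inl s) ∉ N))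
      (fun p _ => N ∪ p.2.image fun s => b (Sum.inl s)) ?_ ?_ ?_ ?_
    · intro F hF
      rw [Finset.mem_filter] at hF
      exact mem_criticalPairs_of_critical hH hlab hG hb hbN hF.1 hF.2
    · rintro ⟨A, D⟩ hp
      have h := union_image_mem_of_mem_criticalPairs hH hlab hG hb hp
      exact Finset.mem_filter.2 ⟨h.1.1, h.2.1⟩
    · intro F hF
      rw [Finset.mem_filter] at hF
      exact union_basePoints_eq_of_critical hH hlab hG hb hbN hF.1 hF.2
    · rintro ⟨A, D⟩ hp
      have h := union_image_mem_of_mem_criticalPairs hH hlab hG hb hp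
      simp only [h.1.2, h.2.2]
  · intro E _ F _ hEF
    exact ⟨dominatedIndices_mono hEF, Finset.filter_subset_filter _ hEF⟩
  · intro p hp
    exact toggleInvariant_morseMap_fiber hH hlab hG hb hp
  · intro F hF hcrit
    have h1 := mem_criticalPairs_of_critical hH hlab hG hb hbN hF hcrit
    have h2 := card_criticalPairs_fst_add hπ h1
    have h3 := union_basePoints_eq_of_critical hH hlab hG hb hbN hF hcrit
    rw [← Finset.card_image_of_injective _ hbinj] at h2
    rw [← h3, Finset.card_union_of_disjoint]
    · omega
    · rw [Finset.disjoint_right]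
      intro v hv
      obtain ⟨s, hs, rfl⟩ := Finset.mem_image.1 hv
      exact (Finset.mem_filter.1 hs).2.2

end BlowUpCohomology

/-! ### The Hilbert series -/

theorem tInv_div_one_sub_tInv :
    tInv / (1 - tInv) = HahnSeries.ofPowerSeries ℤ ℚ
      (PowerSeries.mk fun i => if i = 0 then 0 else 1) := by
  have h1 : (PowerSeries.mk fun i => if i = 0 then (0 : ℚ) else 1) =
      PowerSeries.X * PowerSeries.mk 1 := by
    ext i
    cases i with
    | zero => simp
    | succ i => simp [PowerSeries.coeff_succ_X_mul]
  have h2 : tInv = HahnSeries.ofPowerSeries ℤ ℚ PowerSeries.X := by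
    rw [HahnSeries.ofPowerSeries_X, tInv]
  have h3 : HahnSeries.ofPowerSeries ℤ ℚ (PowerSeries.mk 1) * (1 - tInv) = 1 := by
    rw [h2, ← map_one (HahnSeries.ofPowerSeries ℤ ℚ), ← map_sub, ← map_mul,
      PowerSeries.mk_one_mul_one_sub_eq_one]
  rw [div_eq_iff (right_ne_zero_of_mul_eq_one h3), h1, map_mul, mul_assoc, h3, mul_one, h2]

/-- Each factor `t⁻¹ + t⁻² + ⋯` chooses the negative entry of `a` at one vertex of `N`. -/
theorem coeff_pow_card_eq_card_nonposVectors {V : Type*} [Fintype V] [LinearOrder V]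
    (N : Finset V) (ℓ : ℤ) :
    ((tInv / (1 - tInv)) ^ N.card).coeff (-ℓ) =
      (((nonposVectors V ℓ).filter fun a => (Finset.univ.filter fun v => a v ≠ 0) = N).card : ℚ) := by
  rw [tInv_div_one_sub_tInv, ← map_pow]
  by_cases hℓ : 0 < ℓ
  · have h1 : nonposVectors V ℓ = ∅ := by
      refine Finset.eq_empty_of_forall_notMem fun a ha => ?_
      obtain ⟨h1, h2⟩ := mem_nonposVectors.1 ha
      have := Finset.sum_nonpos fun v (_ : v ∈ Finset.univ) => h1 v
      omega
    rw [h1, PowerSeries.coeff_coe, if_pos (by omega)]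
    simp
  · obtain ⟨e, he⟩ : ∃ e : ℕ, -ℓ = e := ⟨(-ℓ).toNat, by omega⟩
    rw [he, LaurentSeries.coeff_coe_powerSeries, ← Finset.prod_const, PowerSeries.coeff_prod]
    simp only [PowerSeries.coeff_mk]
    have h1 : ∀ l : V →₀ ℕ, (∏ v ∈ N, if l v = 0 then (0 : ℚ) else 1) =
        if ∀ v ∈ N, l v ≠ 0 then 1 else 0 := by
      intro l
      split_ifs with h
      · exact Finset.prod_eq_one fun v hv => if_neg (h v hv)
      · push Not at h
        obtain ⟨v, hv, h0⟩ := h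
        exact Finset.prod_eq_zero hv (if_pos h0)
    simp only [h1]
    rw [Finset.sum_boole, Nat.cast_inj]
    refine Finset.card_bij' (fun l _ v => -(l v : ℤ))
      (fun a _ => Finsupp.equivFunOnFinite.symm fun v => (-a v).toNat) ?_ ?_ ?_ ?_
    · intro l hl
      rw [Finset.mem_filter, Finset.mem_finsuppAntidiag] at hl
      obtain ⟨⟨h2, h3⟩, h4⟩ := hl
      rw [Finset.mem_filter, mem_nonposVectors]
      refine ⟨⟨fun v => by simp, ?_⟩, ?_⟩
      · rw [Finset.sum_neg_distrib, ← Nat.cast_sum]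
        have : ∑ v, l v = ∑ v ∈ N, l v := by
          refine (Finset.sum_subset (Finset.subset_univ N) fun v _ hv => ?_).symm
          by_contra h0
          exact hv (h3 (Finsupp.mem_support_iff.2 h0))
        rw [this, h2]
        omega
      · ext v
        simp only [Finset.mem_filter, Finset.mem_univ, true_and, ne_eq, neg_eq_zero,
          Nat.cast_eq_zero]
        exact ⟨fun h => h3 (Finsupp.mem_support_iff.2 h), fun h => h4 v h⟩
    · intro a ha
      rw [Finset.mem_filter, mem_nonposVectors] at ha
      obtain ⟨⟨h2, h3⟩, rfl⟩ := ha
      rw [Finset.mem_filter, Finset.mem_finsuppAntidiag]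
      simp only [Finsupp.equivFunOnFinite_symm_apply_apply]
      refine ⟨⟨?_, ?_⟩, ?_⟩
      · have h4 : ∑ v ∈ Finset.univ.filter (fun v => a v ≠ 0), (-a v).toNat =
            ∑ v, (-a v).toNat := by
          refine Finset.sum_subset (Finset.subset_univ _) fun v _ hv => ?_
          have : a v = 0 := by simpa using hv
          simp [this]
        rw [h4]
        zify
        rw [Finset.sum_congr rfl fun v _ => Int.toNat_of_nonneg (neg_nonneg.2 (h2 v)),
          Finset.sum_neg_distrib, h3, he]
      · intro v hv
        rw [Finsupp.mem_support_iff, Finsupp.equivFunOnFinite_symm_apply_apply] at hv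
        simp only [Finset.mem_filter, Finset.mem_univ, true_and]
        intro h0
        simp [h0] at hv
      · intro v hv
        have := h2 v
        simp only [Finset.mem_filter, Finset.mem_univ, true_and] at hv
        omega
    · intro l _
      ext v
      simp
    · intro a ha
      rw [Finset.mem_filter, mem_nonposVectors] at ha
      funext v
      have := ha.1.1 v
      simp only [Finsupp.equivFunOnFinite_symm_apply_apply]
      omega

/-! ### Assembling the series and translating the indices -/

section Main

variable {d₀ : ℕ} {H : SimpleGraph (Fin d₀ ⊕ Fin d₀)}

/-- The vertices over the facet of index `A` with `{x_s : s ∈ D}` removed. -/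
def facetPreimage {V : Type*} [Fintype V] (π : V → Fin d₀ ⊕ Fin d₀) (A D : Finset (Fin d₀)) :
    Finset V :=
  Finset.univ.filter fun v => π v ∈ (A \ D).disjSum Aᶜ

/-- A facet contains exactly one of `x_s`, `y_s` for each `s`, and both have fibres of size `n s`;
removing `D` costs `∑ s ∈ D, n s`. -/
theorem card_facetPreimage_add {V : Type*} [Fintype V] [DecidableEq V] {π : V → Fin d₀ ⊕ Fin d₀}
    {n : Fin d₀ → ℕ} (hl : ∀ s, (Finset.univ.filter fun v => π v = Sum.inl s).card = n s)
    (hr : ∀ s, (Finset.univ.filter fun v => π v = Sum.inr s).card = n s)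
    {A D : Finset (Fin d₀)} (hDA : D ⊆ A) :
    (facetPreimage π A D).card + ∑ s ∈ D, n s = ∑ s, n s := by
  have h1 : (facetPreimage π A D).card = ∑ u ∈ (A \ D).disjSum Aᶜ, (u.elim n n) := by
    rw [Finset.card_eq_sum_card_fiberwise (f := π) (s := facetPreimage π A D) (t := (A \ D).disjSum Aᶜ)
      (fun v hv => (Finset.mem_filter.1 hv).2)]
    refine Finset.sum_congr rfl fun u hu => ?_
    have h2 : (facetPreimage π A D).filter (fun v => π v = u) =
        Finset.univ.filter fun v => π v = u := by
      ext v
      simp only [facetPreimage, Finset.mem_filter, Finset.mem_univ, true_and]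
      constructor
      · exact fun h => h.2
      · rintro rfl; exact ⟨hu, rfl⟩
    rw [h2]
    rcases u with s | s
    · exact hl s
    · exact hr s
  rw [h1, Finset.sum_disjSum]
  simp only [Sum.elim_inl, Sum.elim_inr]
  rw [add_right_comm, Finset.sum_sdiff hDA, Finset.sum_add_sum_compl]

theorem weightOf_map_inl (n : Fin d₀ → ℕ) (D : Finset (Fin d₀)) :
    weightOf n (D.map Function.Embedding.inl) = ∑ s ∈ D, n s := by
  rw [weightOf]
  congr 1
  ext s
  simp

open Classical in
-- A pair `(A, D)` is critical for exactly one `N`, so interchanging the sums leaves for each pair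
-- the number of vectors `a ≤ 0` with sum `ℓ` and that support.
theorem finrank_localCohomologyDegree_blowUp {k : Type*} [Field k] (hH : IsVeryWellCovered H)
    (hlab : IsStandardLabelling H) {V : Type*} [Fintype V] [LinearOrder V] {G : SimpleGraph V}
    {π : V → Fin d₀ ⊕ Fin d₀} (hG : ∀ u v, G.Adj u v ↔ H.Adj (π u) (π v))
    (hπ : Function.Surjective π) (j : ℕ) (ℓ : ℤ) :
    (Module.finrank k (LocalCohomologyDegree (edgeIdeal k G) j ℓ) : ℚ) =
      (∑ A ∈ Finset.univ.filter (IsFacetIndex H), ∑ D ∈ (restrictionIndices H A).powerset,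
        if j = (facetPreimage π A D).card + D.card then
          (tInv / (1 - tInv)) ^ (facetPreimage π A D).card else 0).coeff (-ℓ) := by
  have h1 : ∀ a ∈ nonposVectors V ℓ,
      Module.finrank k (SetFamily.Cohomology k (degreeFamily G a) j) =
      ∑ A ∈ Finset.univ.filter (IsFacetIndex H), ∑ D ∈ (restrictionIndices H A).powerset,
        if j = (facetPreimage π A D).card + D.card then
          (if (Finset.univ.filter fun v => a v ≠ 0) = facetPreimage π A D then 1 else 0)
        else 0 := by
    intro a ha
    rw [degreeFamily_of_nonpos (mem_nonposVectors.1 ha).1,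
      finrank_cohomology_starFamily hH hlab hG hπ, Finset.sum_sigma', Finset.card_eq_sum_ones]
    simp only [← ite_and]
    rw [← Finset.sum_filter]
    refine Finset.sum_bij' (fun p _ => ⟨p.1, p.2⟩) (fun p _ => (p.1, p.2)) ?_ ?_ ?_ ?_ ?_
    · rintro ⟨A, D⟩ hp
      rw [Finset.mem_filter, mem_criticalPairs] at hp
      obtain ⟨⟨h1, h2, h3⟩, h4⟩ := hp
      have h3 : (Finset.univ.filter fun v => a v ≠ 0) = facetPreimage π A D := h3
      rw [h3] at h4
      simp only [Finset.mem_filter, Finset.mem_sigma, Finset.mem_univ, true_and,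
        Finset.mem_powerset]
      exact ⟨⟨h1, h2⟩, h4, h3⟩
    · rintro ⟨A, D⟩ hp
      simp only [Finset.mem_filter, Finset.mem_sigma, Finset.mem_univ, true_and,
        Finset.mem_powerset] at hp
      obtain ⟨⟨h1, h2⟩, h4, h3⟩ := hp
      rw [Finset.mem_filter, mem_criticalPairs]
      refine ⟨⟨h1, h2, h3⟩, ?_⟩
      rw [h3]
      exact h4
    · intro p _; rfl
    · intro p _; rfl
    · intro p _; rfl
  rw [finrank_localCohomologyDegree, Finset.sum_congr rfl h1, Finset.sum_comm, Nat.cast_sum,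
    HahnSeries.coeff_sum]
  refine Finset.sum_congr rfl fun A _ => ?_
  rw [Finset.sum_comm, Nat.cast_sum, HahnSeries.coeff_sum]
  refine Finset.sum_congr rfl fun D _ => ?_
  split_ifs
  · rw [coeff_pow_card_eq_card_nonposVectors, Finset.sum_boole]
    simp
  · simp

theorem sum_minVertexCovers_eq (hH : IsVeryWellCovered H) (hlab : IsStandardLabelling H)
    [DecidablePred (IsFacetIndex H)] {M : Type*} [AddCommMonoid M]
    (f : Finset (Fin d₀ ⊕ Fin d₀) → M) :
    ∑ C ∈ minVertexCovers H, f C =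
      ∑ A ∈ Finset.univ.filter (IsFacetIndex H), f (Aᶜ.disjSum A) := by
  symm
  refine Finset.sum_bij (fun A _ => Aᶜ.disjSum A) ?_ ?_ ?_ (fun _ _ => rfl)
  · intro A hA
    exact (compl_disjSum_mem_minVertexCovers_iff hH).2 (Finset.mem_filter.1 hA).2
  · intro A _ B _ h
    ext s
    have := congrArg (Sum.inr s ∈ ·) h
    simpa using this
  · intro C hC
    obtain ⟨A, rfl⟩ := hH.exists_eq_disjSum hlab hC
    exact ⟨A, Finset.mem_filter.2
      ⟨Finset.mem_univ _, (compl_disjSum_mem_minVertexCovers_iff hH).1 hC⟩, rfl⟩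

theorem sum_powerset_map_inl {M : Type*} [AddCommMonoid M] (R : Finset (Fin d₀))
    (f : Finset (Fin d₀ ⊕ Fin d₀) → M) :
    ∑ D ∈ (R.map Function.Embedding.inl).powerset, f D =
      ∑ D ∈ R.powerset, f (D.map Function.Embedding.inl) := by
  symm
  refine Finset.sum_bij (fun D _ => D.map Function.Embedding.inl) ?_ ?_ ?_ (fun _ _ => rfl)
  · intro D hD
    rw [Finset.mem_powerset] at *
    exact Finset.map_subset_map.2 hD
  · intro D _ E _ h
    exact Finset.map_injective _ h
  · intro D hD
    rw [Finset.mem_powerset, Finset.subset_map_iff] at hD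
    obtain ⟨E, hE, rfl⟩ := hD
    exact ⟨E, Finset.mem_powerset.2 hE, rfl⟩

open Classical in
theorem sum_exchangeSet_eq (hH : IsVeryWellCovered H) (hlab : IsStandardLabelling H)
    {V : Type*} [Fintype V] {π : V → Fin d₀ ⊕ Fin d₀} {n : Fin d₀ → ℕ}
    (hl : ∀ s, (Finset.univ.filter fun v => π v = Sum.inl s).card = n s)
    (hr : ∀ s, (Finset.univ.filter fun v => π v = Sum.inr s).card = n s)
    (hV : Fintype.card V = 2 * ∑ s, n s) {K : Type*} [Field K] (w : K) (j : ℕ) :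
    (∑ i ∈ Finset.range (d₀ + 1), ∑ C ∈ minVertexCovers H,
      (((exchangeSet H C).powerset.filter fun D =>
        (∑ s, n s) + weightOf n D + j = Fintype.card V + i ∧ D.card = i).card : K) *
        w ^ ((j : ℤ) - (i : ℤ))) =
    ∑ A ∈ Finset.univ.filter (IsFacetIndex H), ∑ D ∈ (restrictionIndices H A).powerset,
      if j = (facetPreimage π A D).card + D.card then w ^ (facetPreimage π A D).card else 0 := by
  rw [Finset.sum_comm, sum_minVertexCovers_eq hH hlab]
  refine Finset.sum_congr rfl fun A hA => ?_
  rw [exchangeSet_eq hH hlab (Finset.mem_filter.1 hA).2]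
  have h1 : ∀ i ∈ Finset.range (d₀ + 1),
      ((((restrictionIndices H A).map Function.Embedding.inl).powerset.filter fun D =>
        (∑ s, n s) + weightOf n D + j = Fintype.card V + i ∧ D.card = i).card : K) *
        w ^ ((j : ℤ) - (i : ℤ)) =
      ∑ D ∈ (restrictionIndices H A).powerset,
        if D.card = i then
          (if j = (facetPreimage π A D).card + D.card then w ^ (facetPreimage π A D).card else 0)
        else 0 := by
    intro i _
    rw [← Finset.sum_boole, sum_powerset_map_inl, Finset.sum_mul]
    refine Finset.sum_congr rfl fun D hD => ?_
    have h2 := card_facetPreimage_add hl hr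
      (fun s hs => (mem_restrictionIndices.1 (Finset.mem_powerset.1 hD hs)).1 : D ⊆ A)
    rw [weightOf_map_inl, Finset.card_map, hV, ite_mul, one_mul, zero_mul, ← ite_and]
    -- With `|V| = 2d` and `|N| = d - N_D`, the equation `d + N_D + j = |V| + i` says `j = |N| + i`.
    have h3 : ((∑ s, n s) + ∑ s ∈ D, n s + j = 2 * ∑ s, n s + i ∧ D.card = i) ↔
        (D.card = i ∧ j = (facetPreimage π A D).card + D.card) := by
      constructor
      · rintro ⟨h, rfl⟩
        exact ⟨rfl, by omega⟩
      · rintro ⟨rfl, h⟩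
        exact ⟨by omega, rfl⟩
    simp only [h3]
    split_ifs with h
    · obtain ⟨rfl, h⟩ := h
      have : (j : ℤ) - (D.card : ℤ) = ((facetPreimage π A D).card : ℕ) := by omega
      rw [this, zpow_natCast]
    · rfl
  rw [Finset.sum_congr rfl h1, Finset.sum_comm]
  refine Finset.sum_congr rfl fun D _ => ?_
  -- The only contributing `i` is `|D|`, and `|D| ≤ d₀` keeps it inside the range of summation.
  rw [Finset.sum_ite_eq, if_pos]
  have := Finset.card_le_univ D
  rw [Fintype.card_fin] at this
  exact Finset.mem_range.2 (Nat.lt_succ_of_le this)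

theorem card_filter_sigma_fst {ι : Type*} [Fintype ι] [DecidableEq ι] (n : ι → ℕ) (s : ι) :
    (Finset.univ.filter fun p : Σ i, Fin (n i) => p.1 = s).card = n s := by
  have : (Finset.univ.filter fun p : Σ i, Fin (n i) => p.1 = s) =
      (Finset.univ : Finset (Fin (n s))).map (Function.Embedding.sigmaMk s) := by
    ext ⟨i, a⟩
    simp only [Finset.mem_filter, Finset.mem_univ, true_and, Finset.mem_map,
      Function.Embedding.sigmaMk_apply]
    constructor
    · rintro rfl; exact ⟨a, rfl⟩
    · rintro ⟨b, hb⟩; exact (congrArg Sigma.fst hb).symm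
  rw [this, Finset.card_map, Finset.card_univ, Fintype.card_fin]

/-- Only the projection to `V(H)` matters afterwards: adjacency is pulled back along it, and its
fibres have the prescribed sizes, nonempty because each `n s` is positive. -/
theorem exists_blowUp_projection (n : Fin d₀ → ℕ) (hn : ∀ s, 0 < n s) {V : Type*} [Fintype V]
    {G : SimpleGraph V} (hG : Nonempty (G ≃g replaceEdges H n)) :
    ∃ π : V → Fin d₀ ⊕ Fin d₀, (∀ u v, G.Adj u v ↔ H.Adj (π u) (π v)) ∧ Function.Surjective π ∧
      (∀ s, (Finset.univ.filter fun v => π v = Sum.inl s).card = n s) ∧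
      (∀ s, (Finset.univ.filter fun v => π v = Sum.inr s).card = n s) ∧
      Fintype.card V = 2 * ∑ s, n s := by
  obtain ⟨e⟩ := hG
  have key : ∀ (q : ReplacedVertex n → Prop) [DecidablePred q],
      (Finset.univ.filter fun v => q (e v)).card = (Finset.univ.filter q).card := by
    intro q _
    refine Finset.card_bij (fun v _ => e v) (by simp) (fun _ _ _ _ h => e.injective h) ?_
    intro w hw
    exact ⟨e.symm w, by simpa using hw, by simp⟩
  refine ⟨fun v => Sum.map Sigma.fst Sigma.fst (e v), fun u v => ?_, ?_, fun s => ?_, fun s => ?_, ?_⟩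
  · exact (e.map_rel_iff (a := u) (b := v)).symm
  · rintro (s | s)
    · exact ⟨e.symm (Sum.inl ⟨s, ⟨0, hn s⟩⟩), by simp⟩
    · exact ⟨e.symm (Sum.inr ⟨s, ⟨0, hn s⟩⟩), by simp⟩
  · rw [key fun w => Sum.map Sigma.fst Sigma.fst w = Sum.inl s, ← card_filter_sigma_fst n s]
    refine Eq.trans ?_ (Finset.card_map (Function.Embedding.inl (β := Σ i, Fin (n i))))
    refine congrArg Finset.card (Finset.ext ?_)
    rintro (w | w) <;> simp
  · rw [key fun w => Sum.map Sigma.fst Sigma.fst w = Sum.inr s, ← card_filter_sigma_fst n s]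
    refine Eq.trans ?_ (Finset.card_map (Function.Embedding.inr (α := Σ i, Fin (n i))))
    refine congrArg Finset.card (Finset.ext ?_)
    rintro (w | w) <;> simp
  · rw [Fintype.card_congr e.toEquiv, Fintype.card_sum, Fintype.card_sigma]
    simp only [Fintype.card_fin]
    ring

end Main

end

theorem mainTheorem12 {k : Type*} [Field k] {d₀ : ℕ}
    (H : SimpleGraph (Fin d₀ ⊕ Fin d₀)) (hH : IsVeryWellCovered H) (hlab : IsStandardLabelling H)
    (n : Fin d₀ → ℕ) (hn : ∀ s, 0 < n s)
    {V : Type*} [Fintype V] [LinearOrder V] (G : SimpleGraph V)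
    (hG : Nonempty (G ≃g replaceEdges H n))
    (j : ℕ) (hj : 0 < j) :
    (∀ ℓ : ℤ, Module.Finite k (LocalCohomologyDegree (edgeIdeal k G) j ℓ)) ∧
    ∀ ℓ : ℤ, (Module.finrank k (LocalCohomologyDegree (edgeIdeal k G) j ℓ) : ℚ) =
      (∑ i ∈ Finset.range (d₀ + 1), ∑ C ∈ minVertexCovers H,
        (((exchangeSet H C).powerset.filter fun D =>
          (∑ s, n s) + weightOf n D + j = Fintype.card V + i ∧ D.card = i).card : LaurentSeries ℚ) *
        (tInv / (1 - tInv)) ^ ((j : ℤ) - (i : ℤ))).coeff (-ℓ) := by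
  obtain ⟨π, hadj, hπ, hl, hr, hV⟩ := exists_blowUp_projection n hn hG
  refine ⟨finite_localCohomologyDegree k G j, fun ℓ => ?_⟩
  rw [finrank_localCohomologyDegree_blowUp hH hlab hadj hπ, sum_exchangeSet_eq hH hlab hl hr hV]
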